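/- Let $d\ge 2$ and $\delta'>\delta>0$. There is a constant $C>0$, depending only on $d,\delta,\delta'$, with the following property. Let $\Omega\subseteq\mathbb R^d$ be open and let $d_\Omega(x)=\operatorname{dist}(x,\mathbb R^d\setminus\Omega)$ (with $d_\Omega\equiv\infty$ if $\Omega=\mathbb R^d$). Let $H$ be a nonnegative self-adjoint operator in the complex Hilbert space $L^2(\Omega)$ with $C_0^\infty(\Omega)\subset\operatorname{dom}(H)$ and $H\varphi=-\Delta\varphi$ for all $\varphi\in C_0^\infty(\Omega)$. Let $k_H$ be its heat kernel, that is, the continuous function on $(0,\infty)\times\Omega\times\Omega$ such that, for all $t>0$ and $f\in L^2(\Omega)$, $(e^{-tH}f)(x)=\int_\Omega k_H(t,x,y)f(y)\,dy$ for almost every $x\in\Omega$. For $x\in\Omega$ and $P\subseteq(0,\infty)\times\mathbb R^d$ define $$\|k_H\|_{G^\infty_{\delta,x}(P)}:=\sup_{(s,y)\in P,\ y\in\overline\Omega}\ \limsup_{\Omega\ni y'\to y}|k_H(s,x,y')|\,s^{d/2}\,e^{\frac{|x-y|^2}{4(1+\delta)s}}\in[0,\infty].$$ Then for all $x\in\Omega$,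 all $t>0$ and all finite $R$ with $0<R\le d_\Omega(x)$, $$\bigl|(4\pi t)^{d/2}k_H(t,x,x)-1\bigr|\le C\Bigl(1+\log_+\Bigl(\frac{\sqrt t}{R}\Bigr)\Bigr)^{\kappa_d}\,\|k_H\|_{G^\infty_{\delta,x}((0,t]\times B_R(x))}\,e^{-\frac{R^2}{(1+\delta')t}},$$ where $B_R(x)$ is the open ball, $\log_+ r=\max\{0,\log r\}$, $\kappa_2=1$ and $\kappa_d=0$ for $d\ge3$. (If the norm is infinite, the right-hand side is $+\infty$.) -/

import Mathlib

open MeasureTheory Filter Topology Set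
open scoped ENNReal ContDiff Laplacian

noncomputable section

/-- The complex Hilbert space `L²(Ω)` for `Ω ⊆ ℝ^d`, with Lebesgue measure on `Ω`. -/
abbrev L2 {d : ℕ} (Ω : Set (EuclideanSpace ℝ (Fin d))) : Type :=
  Lp ℂ 2 (volume.restrict Ω)

/-- `H` is a nonnegative self-adjoint (possibly unbounded) operator in `L²(Ω)` that extends `-Δ`
from `C_0^∞(Ω)`: every `φ ∈ C_0^∞(Ω)` lies in the domain of `H`, and `H φ = -Δ φ`. -/
structure IsNonnegSelfAdjointExtension {d : ℕ} (Ω : Set (EuclideanSpace ℝ (Fin d)))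
    (H : L2 Ω →ₗ.[ℂ] L2 Ω) : Prop where
  selfAdjoint : IsSelfAdjoint H
  nonneg : ∀ u : H.domain, 0 ≤ (inner ℂ (u : L2 Ω) (H u)).re
  extends_neg_laplacian : ∀ φ : EuclideanSpace ℝ (Fin d) → ℂ, ContDiff ℝ ∞ φ →
    HasCompactSupport φ → tsupport φ ⊆ Ω →
    ∀ u v : L2 Ω, u =ᵐ[volume.restrict Ω] φ →
      v =ᵐ[volume.restrict Ω] (fun x => -(Δ φ) x) → (u, v) ∈ H.graph

/-- `S t = e^{-tH}` for `t ≥ 0`: the family `S` is the strongly continuous one-parameter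
semigroup whose generator is `-H` (with exactly the domain of `H`). The values `S t` for `t < 0`
are irrelevant. -/
structure IsSemigroupGeneratedByNeg {d : ℕ} {Ω : Set (EuclideanSpace ℝ (Fin d))}
    (H : L2 Ω →ₗ.[ℂ] L2 Ω) (S : ℝ → L2 Ω →L[ℂ] L2 Ω) : Prop where
  zero : S 0 = ContinuousLinearMap.id ℂ (L2 Ω)
  add : ∀ s t : ℝ, 0 ≤ s → 0 ≤ t → S (s + t) = (S s).comp (S t)
  strongly_continuous : ∀ f : L2 Ω, ContinuousOn (fun t => S t f) (Ici 0)
  generator : ∀ f g : L2 Ω, (f, g) ∈ H.graph ↔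
    Tendsto (fun t : ℝ => t⁻¹ • (f - S t f)) (𝓝[>] 0) (𝓝 g)

/-- `k` is the heat kernel of `H`: it is continuous on `(0,∞) × Ω × Ω`, and for every `t > 0` it is
the integral kernel of `e^{-tH}`, that is `(e^{-tH} f)(x) = ∫_Ω k(t,x,y) f(y) dy` for every
`f ∈ L²(Ω)` and almost every `x ∈ Ω`, with an absolutely convergent integral.
These properties determine `k` on `(0,∞) × Ω × Ω`. -/
def IsHeatKernel {d : ℕ} {Ω : Set (EuclideanSpace ℝ (Fin d))} (H : L2 Ω →ₗ.[ℂ] L2 Ω)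
    (k : ℝ → EuclideanSpace ℝ (Fin d) → EuclideanSpace ℝ (Fin d) → ℂ) : Prop :=
  ContinuousOn (fun p : ℝ × EuclideanSpace ℝ (Fin d) × EuclideanSpace ℝ (Fin d) =>
    k p.1 p.2.1 p.2.2) (Ioi 0 ×ˢ Ω ×ˢ Ω) ∧
  ∃ S : ℝ → L2 Ω →L[ℂ] L2 Ω, IsSemigroupGeneratedByNeg H S ∧
    ∀ t : ℝ, 0 < t → ∀ f : L2 Ω, ∀ᵐ x ∂(volume.restrict Ω),
      IntegrableOn (fun y => k t x y * f y) Ω volume ∧ S t f x = ∫ y in Ω, k t x y * f y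

/-- The weighted norm `‖f‖_{G^∞_{δ,x}(P)} ∈ [0,∞]`, for `P ⊆ (0,∞) × ℝ^d`: the supremum over
`(s,y) ∈ P` with `y ∈ closure Ω` of
`limsup_{Ω ∋ y' → y} |f(s,x,y')| s^{d/2} exp(|x-y|² / (4(1+δ)s))`. -/
def gNorm {d : ℕ} (Ω : Set (EuclideanSpace ℝ (Fin d))) (δ : ℝ) (x : EuclideanSpace ℝ (Fin d))
    (P : Set (ℝ × EuclideanSpace ℝ (Fin d)))
    (f : ℝ → EuclideanSpace ℝ (Fin d) → EuclideanSpace ℝ (Fin d) → ℂ) : ℝ≥0∞ :=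
  ⨆ p ∈ P ∩ (Ioi 0 ×ˢ closure Ω),
    limsup (fun y' => ENNReal.ofReal
      (‖f p.1 x y'‖ * p.1 ^ ((d : ℝ) / 2) * Real.exp (‖x - p.2‖ ^ 2 / (4 * (1 + δ) * p.1))))
      (𝓝[Ω] p.2)

/-- The exponent of the logarithm: `κ_2 = 1` and `κ_d = 0` for `d ≥ 3`. -/
def kappa (d : ℕ) : ℕ := if d = 2 then 1 else 0

end

/-! ### The Gaussian as a radial function, its cutoff and the commutator. -/

section RadialProfiles

variable {d : ℕ}

/-! The proof is a localized Duhamel comparison with the free heat kernel. Fix x, put u(s,y) =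
k(s,x,y), let g_σ be the free kernel centred at x and η a smooth radial cutoff, equal to 1 near x
and supported inside B_R(x). The function F(s) = ∫ η g_{t-s} u(s) dy runs from (4πt)^{-d/2} as s → 0
to k(t,x,x) as s → t. Since g and u both solve the heat equation, F'(s) = ∫ ([Δ,η] g_{t-s}) u(s) dy;
this is `IsWeakHeatSolution.hasDerivAt_integral_cutGauss`, integrated in
`IsWeakHeatSolution.norm_sub_le`.

The commutator lives on an annulus αR² ≤ |y-x|² ≤ βR² with α < β < 1 close to 1. There the two
Gaussian factors give exp(-αR²/(4(t-s)) - αR²/(4(1+δ)s)), and 1/s + 1/(t-s) ≥ 4/t turns this into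
exp(-R²/((1+δ')t)) with a surplus that absorbs all negative powers of s and t-s
(`exists_duhamel_integrand_bound`). The remaining time integral is bounded for d ≥ 3 and logarithmic
for d = 2 (`integral_heatMajorant_le`).

Two facts about k need proof. First, k(s,x,·) solves the heat equation weakly for every x: the L²
identity d/ds e^{-sH}φ = e^{-sH}Δφ is made pointwise by continuity (`kernelAction_sub`). Second, F
has the right limit at 0, that is, e^{-sH}φ → φ at the point x for test functions φ
(`tendsto_kernelAction`). The semigroup gives this only in L²; the same Duhamel estimate, applied to
e^{-sH}φ, upgrades it. -/

theorem contDiff_deriv {f : ℝ → ℝ} (hf : ContDiff ℝ ∞ f) : ContDiff ℝ ∞ (deriv f) := by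
  have h : ContDiff ℝ ((∞ : ℕ∞ω) + 1) f := by simpa using hf
  exact (contDiff_succ_iff_deriv.1 h).2.2

theorem contDiff_hasDerivAt {f : ℝ → ℝ} (hf : ContDiff ℝ ∞ f) (r : ℝ) :
    HasDerivAt f (deriv f r) r :=
  ((hf.differentiable (by simp)) r).hasDerivAt

/-- The heat kernel `(4πσ)^{-d/2} e^{-r/(4σ)}` as a function of time `σ` and squared distance `r`. -/
noncomputable def gaussProfile (d : ℕ) (σ r : ℝ) : ℝ :=
  (4 * Real.pi * σ) ^ (-((d : ℝ) / 2)) * Real.exp (-(r / (4 * σ)))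

/-- The heat kernel centred at `x`, multiplied by the radial cutoff `η(|y-x|²)`. -/
noncomputable def cutGauss (η : ℝ → ℝ) (x : EuclideanSpace ℝ (Fin d)) (σ : ℝ)
    (y : EuclideanSpace ℝ (Fin d)) : ℝ :=
  η (‖y - x‖ ^ 2) * gaussProfile d σ (‖y - x‖ ^ 2)

/-- The commutator of the Laplacian with the radial cutoff `η(|y-x|²)`, applied to the heat kernel
centred at `x`. -/
noncomputable def cutGaussCommutator (η : ℝ → ℝ) (x : EuclideanSpace ℝ (Fin d)) (σ : ℝ)
    (y : EuclideanSpace ℝ (Fin d)) : ℝ :=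
  (4 * ‖y - x‖ ^ 2 * deriv (deriv η) (‖y - x‖ ^ 2) + 2 * d * deriv η (‖y - x‖ ^ 2)
    - 2 * ‖y - x‖ ^ 2 / σ * deriv η (‖y - x‖ ^ 2)) * gaussProfile d σ (‖y - x‖ ^ 2)

theorem gaussProfile_pos {σ : ℝ} (hσ : 0 < σ) (r : ℝ) : 0 < gaussProfile d σ r := by
  unfold gaussProfile; positivity

theorem hasDerivAt_gaussProfile_time {σ : ℝ} (hσ : 0 < σ) (r : ℝ) :
    HasDerivAt (fun s => gaussProfile d s r)
      ((r / (4 * σ ^ 2) - d / (2 * σ)) * gaussProfile d σ r) σ := by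
  unfold gaussProfile
  have h1 : HasDerivAt (fun s : ℝ => 4 * Real.pi * s) (4 * Real.pi) σ := by
    simpa using (hasDerivAt_id σ).const_mul (4 * Real.pi)
  have hne : 4 * Real.pi * σ ≠ 0 := by positivity
  have h2 := h1.rpow_const (p := -((d : ℝ) / 2)) (Or.inl hne)
  have h3 : HasDerivAt (fun s : ℝ => -(r / (4 * s))) (r / (4 * σ ^ 2)) σ := by
    have h := ((hasDerivAt_inv hσ.ne').const_mul (-(r / 4)))
    refine (h.congr_deriv ?_).congr_of_eventuallyEq ?_
    · field_simp
    · filter_upwards [eventually_ne_nhds hσ.ne'] with s hs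
      field_simp
  refine (h2.mul h3.exp).congr_deriv ?_
  rw [Real.rpow_sub_one hne]
  field_simp
  ring

theorem hasDerivAt_gaussProfile_space (σ r : ℝ) :
    HasDerivAt (fun s => gaussProfile d σ s) (-(1 / (4 * σ)) * gaussProfile d σ r) r := by
  unfold gaussProfile
  have h3 : HasDerivAt (fun s : ℝ => -(s / (4 * σ))) (-(1 / (4 * σ))) r :=
    ((hasDerivAt_id r).div_const _).neg
  refine (h3.exp.const_mul _).congr_deriv ?_
  ring

theorem contDiff_gaussProfile_space (σ : ℝ) : ContDiff ℝ ∞ (fun s => gaussProfile d σ s) := by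
  unfold gaussProfile
  fun_prop

theorem continuousOn_gaussProfile :
    ContinuousOn (fun p : ℝ × ℝ => gaussProfile d p.1 p.2) (Ioi 0 ×ˢ univ) := by
  unfold gaussProfile
  intro p hp
  have hp1 : 0 < p.1 := hp.1
  apply ContinuousAt.continuousWithinAt
  refine ContinuousAt.mul (ContinuousAt.rpow (by fun_prop) continuousAt_const (Or.inl ?_)) ?_
  · positivity
  · have : 4 * p.1 ≠ 0 := by positivity
    fun_prop (disch := assumption)

/-- The Laplacian of a radial function `y ↦ Φ(|y-x|²)`. -/
theorem laplacian_comp_norm_sq {Φ : ℝ → ℝ} (hΦ : ContDiff ℝ ∞ Φ)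
    (x y : EuclideanSpace ℝ (Fin d)) :
    (Δ (fun z : EuclideanSpace ℝ (Fin d) => Φ (‖z - x‖ ^ 2))) y =
      4 * ‖y - x‖ ^ 2 * deriv (deriv Φ) (‖y - x‖ ^ 2) + 2 * d * deriv Φ (‖y - x‖ ^ 2) := by
  have hsq : ∀ z : EuclideanSpace ℝ (Fin d), HasFDerivAt
      (fun z : EuclideanSpace ℝ (Fin d) => ‖z - x‖ ^ 2) ((2 : ℝ) • innerSL ℝ (z - x)) z := by
    intro z
    have := ((hasFDerivAt_id z).sub_const x).norm_sq
    rw [ofNat_smul_eq_nsmul]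
    simpa using this
  have hd1 : ∀ r, HasDerivAt Φ (deriv Φ r) r := contDiff_hasDerivAt hΦ
  have hΦ' := contDiff_deriv hΦ
  have hd2 : ∀ r, HasDerivAt (deriv Φ) (deriv (deriv Φ) r) r := contDiff_hasDerivAt hΦ'
  have hf1 : fderiv ℝ (fun z : EuclideanSpace ℝ (Fin d) => Φ (‖z - x‖ ^ 2)) =
      fun z => (2 * deriv Φ (‖z - x‖ ^ 2)) • innerSL ℝ (z - x) := by
    funext z
    refine ((hd1 _).comp_hasFDerivAt z (hsq z)).fderiv.trans ?_
    rw [smul_smul, mul_comm]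
  let B : EuclideanSpace ℝ (Fin d) →L[ℝ] EuclideanSpace ℝ (Fin d) →L[ℝ] ℝ := innerSL ℝ
  have hf2 : HasFDerivAt (fun z : EuclideanSpace ℝ (Fin d) =>
      (2 * deriv Φ (‖z - x‖ ^ 2)) • innerSL ℝ (z - x))
      ((2 * deriv Φ (‖y - x‖ ^ 2)) • B +
        ((2 : ℝ) • deriv (deriv Φ) (‖y - x‖ ^ 2) • (2 : ℝ) • innerSL ℝ (y - x)).smulRight
          (innerSL ℝ (y - x))) y := by
    have ha := ((hd2 _).comp_hasFDerivAt y (hsq y)).const_mul 2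
    have hb : HasFDerivAt (fun z : EuclideanSpace ℝ (Fin d) => innerSL ℝ (z - x))
        B y :=
      B.hasFDerivAt.comp y
        ((hasFDerivAt_id y).sub_const x)
    exact ha.smul hb
  rw [InnerProductSpace.laplacian_eq_iteratedFDeriv_orthonormalBasis _
    (EuclideanSpace.basisFun (Fin d) ℝ)]
  simp only [iteratedFDeriv_two_apply, hf1, hf2.fderiv]
  have hterm : ∀ i, (((2 * deriv Φ (‖y - x‖ ^ 2)) • B +
      ((2 : ℝ) • deriv (deriv Φ) (‖y - x‖ ^ 2) • (2 : ℝ) • innerSL ℝ (y - x)).smulRight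
        (innerSL ℝ (y - x))) (EuclideanSpace.basisFun (Fin d) ℝ i))
        (EuclideanSpace.basisFun (Fin d) ℝ i) =
      4 * deriv (deriv Φ) (‖y - x‖ ^ 2) *
        ‖inner ℝ (EuclideanSpace.basisFun (Fin d) ℝ i) (y - x)‖ ^ 2 +
        2 * deriv Φ (‖y - x‖ ^ 2) := by
    intro i
    have hB : B (EuclideanSpace.basisFun (Fin d) ℝ i) (EuclideanSpace.basisFun (Fin d) ℝ i) = 1 := by
      have h := real_inner_self_eq_norm_sq (EuclideanSpace.basisFun (Fin d) ℝ i)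
      rwa [OrthonormalBasis.norm_eq_one, one_pow] at h
    simp only [add_apply, smul_apply, ContinuousLinearMap.smulRight_apply, innerSL_apply_apply,
      smul_eq_mul, hB, Real.norm_eq_abs, sq_abs]
    rw [real_inner_comm]
    ring
  have hsum := (EuclideanSpace.basisFun (Fin d) ℝ).sum_sq_norm_inner_right (y - x)
  simp only [Matrix.cons_val_zero, Matrix.cons_val_one, hterm, Finset.sum_add_distrib,
    ← Finset.mul_sum, hsum, Finset.sum_const, Finset.card_univ, Fintype.card_fin, nsmul_eq_mul]
  ring

/-- The Gaussian solves the heat equation, so the part where no derivative falls on `η` is exactly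
the time derivative of `cutGauss`. It cancels in Duhamel's formula and only the commutator survives.
-/
theorem laplacian_cutGauss {η : ℝ → ℝ} (hη : ContDiff ℝ ∞ η) {σ : ℝ} (hσ : 0 < σ)
    (x y : EuclideanSpace ℝ (Fin d)) :
    (Δ (cutGauss η x σ)) y = cutGaussCommutator η x σ y +
      η (‖y - x‖ ^ 2) *
        ((‖y - x‖ ^ 2 / (4 * σ ^ 2) - d / (2 * σ)) * gaussProfile d σ (‖y - x‖ ^ 2)) := by
  have hη' := contDiff_deriv hη
  have hd1 : ∀ r, HasDerivAt η (deriv η r) r := contDiff_hasDerivAt hη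
  have hd2 : ∀ r, HasDerivAt (deriv η) (deriv (deriv η) r) r := contDiff_hasDerivAt hη'
  have hg := fun r => hasDerivAt_gaussProfile_space (d := d) σ r
  have e1 : deriv (fun r => η r * gaussProfile d σ r) = fun r =>
      deriv η r * gaussProfile d σ r + η r * (-(1 / (4 * σ)) * gaussProfile d σ r) := by
    funext r
    exact ((hd1 r).mul (hg r)).deriv
  have e2 : ∀ r, deriv (deriv (fun r => η r * gaussProfile d σ r)) r =
      deriv (deriv η) r * gaussProfile d σ r + deriv η r * (-(1 / (4 * σ)) * gaussProfile d σ r) +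
      (deriv η r * (-(1 / (4 * σ)) * gaussProfile d σ r) +
        η r * (-(1 / (4 * σ)) * (-(1 / (4 * σ)) * gaussProfile d σ r))) := by
    intro r
    rw [e1]
    exact (((hd2 r).mul (hg r)).add ((hd1 r).mul ((hg r).const_mul _))).deriv
  have := laplacian_comp_norm_sq (hη.mul (contDiff_gaussProfile_space (d := d) σ)) x y
  change (Δ (fun z => η (‖z - x‖ ^ 2) * gaussProfile d σ (‖z - x‖ ^ 2))) y = _
  rw [this, e2, e1, cutGaussCommutator]
  field_simp
  ring

theorem contDiff_cutGauss {η : ℝ → ℝ} (hη : ContDiff ℝ ∞ η) (x : EuclideanSpace ℝ (Fin d))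
    (σ : ℝ) : ContDiff ℝ ∞ (cutGauss η x σ) := by
  have h1 : ContDiff ℝ ∞ (fun y : EuclideanSpace ℝ (Fin d) => ‖y - x‖ ^ 2) :=
    (contDiff_id.sub contDiff_const).norm_sq ℝ
  exact (hη.comp h1).mul ((contDiff_gaussProfile_space σ).comp h1)

theorem cutGauss_eq_zero {η : ℝ → ℝ} {ρ : ℝ} (hρ : 0 < ρ) (h0 : ∀ r, ρ ^ 2 ≤ r → η r = 0)
    (x : EuclideanSpace ℝ (Fin d)) (σ : ℝ) {y : EuclideanSpace ℝ (Fin d)}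
    (hy : y ∉ Metric.closedBall x ρ) : cutGauss η x σ y = 0 := by
  rw [Metric.mem_closedBall, dist_eq_norm, not_le] at hy
  rw [cutGauss, h0 _ (by gcongr), zero_mul]

/-- Outside the closed ball the inequality is strict, so `η` vanishes near the point in question and
its derivatives vanish too. -/
theorem cutGaussCommutator_eq_zero {η : ℝ → ℝ} {ρ : ℝ} (hρ : 0 < ρ)
    (h0 : ∀ r, ρ ^ 2 ≤ r → η r = 0)
    (x : EuclideanSpace ℝ (Fin d)) (σ : ℝ) {y : EuclideanSpace ℝ (Fin d)}
    (hy : y ∉ Metric.closedBall x ρ) : cutGaussCommutator η x σ y = 0 := by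
  rw [Metric.mem_closedBall, dist_eq_norm, not_le] at hy
  have h1 : ∀ r, ρ ^ 2 < r → deriv η r = 0 := by
    intro r hr
    have : η =ᶠ[𝓝 r] fun _ => 0 := by
      filter_upwards [lt_mem_nhds hr] with s hs using h0 s hs.le
    rw [this.deriv_eq]; simp
  have h2 : ∀ r, ρ ^ 2 < r → deriv (deriv η) r = 0 := by
    intro r hr
    have : deriv η =ᶠ[𝓝 r] fun _ => 0 := by
      filter_upwards [lt_mem_nhds hr] with s hs using h1 s hs
    rw [this.deriv_eq]; simp
  have hlt : ρ ^ 2 < ‖y - x‖ ^ 2 := by gcongr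
  rw [cutGaussCommutator, h1 _ hlt, h2 _ hlt]
  ring

theorem tsupport_cutGauss_subset {η : ℝ → ℝ} {ρ : ℝ} (hρ : 0 < ρ)
    (h0 : ∀ r, ρ ^ 2 ≤ r → η r = 0) (x : EuclideanSpace ℝ (Fin d)) (σ : ℝ) :
    tsupport (cutGauss η x σ) ⊆ Metric.closedBall x ρ :=
  closure_minimal (fun y hy => by
    by_contra hc
    exact hy (cutGauss_eq_zero hρ h0 x σ hc)) Metric.isClosed_closedBall

theorem hasCompactSupport_cutGauss {η : ℝ → ℝ} {ρ : ℝ} (hρ : 0 < ρ)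
    (h0 : ∀ r, ρ ^ 2 ≤ r → η r = 0) (x : EuclideanSpace ℝ (Fin d)) (σ : ℝ) :
    HasCompactSupport (cutGauss η x σ) :=
  HasCompactSupport.intro (isCompact_closedBall x ρ) fun _ hy => cutGauss_eq_zero hρ h0 x σ hy

theorem continuousOn_gaussProfile_norm_sq (x : EuclideanSpace ℝ (Fin d)) :
    ContinuousOn (fun p : ℝ × EuclideanSpace ℝ (Fin d) => gaussProfile d p.1 (‖p.2 - x‖ ^ 2))
      (Ioi 0 ×ˢ univ) :=
  continuousOn_gaussProfile.comp
    (f := fun p : ℝ × EuclideanSpace ℝ (Fin d) => (p.1, ‖p.2 - x‖ ^ 2))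
    (by fun_prop) fun p hp => ⟨hp.1, trivial⟩

theorem continuousOn_cutGauss {η : ℝ → ℝ} (hη : ContDiff ℝ ∞ η)
    (x : EuclideanSpace ℝ (Fin d)) :
    ContinuousOn (fun p : ℝ × EuclideanSpace ℝ (Fin d) => cutGauss η x p.1 p.2)
      (Ioi 0 ×ˢ univ) := by
  have := hη.continuous
  exact ContinuousOn.mul (by fun_prop) (continuousOn_gaussProfile_norm_sq x)

theorem continuousOn_cutGaussCommutator {η : ℝ → ℝ} (hη : ContDiff ℝ ∞ η)
    (x : EuclideanSpace ℝ (Fin d)) :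
    ContinuousOn (fun p : ℝ × EuclideanSpace ℝ (Fin d) => cutGaussCommutator η x p.1 p.2)
      (Ioi 0 ×ˢ univ) := by
  have hη' := contDiff_deriv hη
  have hη'' := contDiff_deriv hη'
  have c1 := hη'.continuous
  have c2 := hη''.continuous
  refine ContinuousOn.mul ?_ (continuousOn_gaussProfile_norm_sq x)
  refine ContinuousOn.sub (by fun_prop) (ContinuousOn.mul ?_ (by fun_prop))
  exact ContinuousOn.div (by fun_prop) (by fun_prop) fun p hp => ne_of_gt hp.1

end RadialProfiles

/-! ### Continuity and integrability of compactly supported families. -/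

section ParametricIntegrals

variable {d : ℕ} {X : Type*} [TopologicalSpace X]

/-- A product `g • u` is continuous on the whole space when `u` is continuous on `Ω` and `g` is
continuous and vanishes outside a closed subset of `Ω`. -/
theorem continuousOn_smul_of_eq_zero {E : Type*} [TopologicalSpace E] {S : Set X} {Ω K : Set E}
    (hΩ : IsOpen Ω) (hK : IsClosed K) (hKΩ : K ⊆ Ω) {g : X → E → ℝ} {u : X → E → ℂ}
    (hg : ContinuousOn (fun p : X × E => g p.1 p.2) (S ×ˢ univ))
    (hu : ContinuousOn (fun p : X × E => u p.1 p.2) (S ×ˢ Ω))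
    (hz : ∀ p ∈ S, ∀ y ∉ K, g p y = 0) :
    ContinuousOn (fun p : X × E => g p.1 p.2 • u p.1 p.2) (S ×ˢ univ) := by
  rintro ⟨p, y⟩ ⟨hp, -⟩
  by_cases hy : y ∈ Ω
  · have h1 : ContinuousWithinAt (fun p : X × E => g p.1 p.2 • u p.1 p.2) (S ×ˢ Ω) (p, y) :=
      ((hg.mono (prod_mono_right (subset_univ _))).smul hu) _ ⟨hp, hy⟩
    refine h1.mono_of_mem_nhdsWithin ?_
    filter_upwards [self_mem_nhdsWithin,
      mem_nhdsWithin_of_mem_nhds ((hΩ.preimage continuous_snd).mem_nhds hy)] with q hq hq2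
    exact ⟨hq.1, hq2⟩
  · have hyK : y ∉ K := fun h => hy (hKΩ h)
    have h1 : ContinuousWithinAt (fun _ : X × E => (0 : ℂ)) (S ×ˢ univ) (p, y) :=
      continuousWithinAt_const
    refine h1.congr_of_eventuallyEq ?_ ?_
    · filter_upwards [self_mem_nhdsWithin, mem_nhdsWithin_of_mem_nhds
        ((hK.isOpen_compl.preimage continuous_snd).mem_nhds hyK)] with q hq hq2
      rw [hz _ hq.1 _ hq2, zero_smul]
    · change g p y • u p y = 0
      rw [hz _ hp _ hyK, zero_smul]

theorem continuousOn_integral_smul {S : Set X} {Ω K : Set (EuclideanSpace ℝ (Fin d))}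
    (hΩ : IsOpen Ω) (hK : IsCompact K) (hKΩ : K ⊆ Ω) {g : X → EuclideanSpace ℝ (Fin d) → ℝ}
    {u : X → EuclideanSpace ℝ (Fin d) → ℂ}
    (hg : ContinuousOn (fun p : X × EuclideanSpace ℝ (Fin d) => g p.1 p.2) (S ×ˢ univ))
    (hu : ContinuousOn (fun p : X × EuclideanSpace ℝ (Fin d) => u p.1 p.2) (S ×ˢ Ω))
    (hz : ∀ p ∈ S, ∀ y ∉ K, g p y = 0) :
    ContinuousOn (fun p => ∫ y, g p y • u p y) S :=
  continuousOn_integral_of_compact_support hK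
    (continuousOn_smul_of_eq_zero hΩ hK.isClosed hKΩ hg hu hz)
    fun p y hp hy => by rw [hz p hp y hy, zero_smul]

theorem continuous_slice {S : Set X} {W : X → EuclideanSpace ℝ (Fin d) → ℂ}
    (hW : ContinuousOn (fun p : X × EuclideanSpace ℝ (Fin d) => W p.1 p.2) (S ×ˢ univ))
    {p : X} (hp : p ∈ S) : Continuous (W p) := by
  rw [← continuousOn_univ]
  exact hW.comp (f := fun y => (p, y)) (by fun_prop) fun y _ => ⟨hp, trivial⟩

/-- A slice of a jointly continuous family that vanishes outside a compact set is integrable. -/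
theorem integrable_slice {S : Set X} {W : X → EuclideanSpace ℝ (Fin d) → ℂ}
    {K : Set (EuclideanSpace ℝ (Fin d))} (hK : IsCompact K)
    (hW : ContinuousOn (fun p : X × EuclideanSpace ℝ (Fin d) => W p.1 p.2) (S ×ˢ univ))
    {p : X} (hp : p ∈ S) (hz : ∀ y ∉ K, W p y = 0) : Integrable (W p) :=
  (continuous_slice hW hp).integrable_of_hasCompactSupport (HasCompactSupport.intro hK hz)

end ParametricIntegrals

/-! ### The Gaussian as an approximate identity. -/

section ApproximateIdentity

variable {d : ℕ}

theorem gaussProfile_one_eq (z : EuclideanSpace ℝ (Fin d)) :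
    gaussProfile d 1 (‖z‖ ^ 2) =
      (4 * Real.pi) ^ (-((d : ℝ) / 2)) * Real.exp (-(1 / 4) * ‖z‖ ^ 2) := by
  rw [gaussProfile]
  ring_nf

theorem integral_gaussProfile_one :
    ∫ z : EuclideanSpace ℝ (Fin d), gaussProfile d 1 (‖z‖ ^ 2) = 1 := by
  simp_rw [gaussProfile_one_eq]
  rw [integral_const_mul, GaussianFourier.integral_rexp_neg_mul_sq_norm (by norm_num)]
  rw [finrank_euclideanSpace_fin, Real.rpow_neg (by positivity)]
  rw [show Real.pi / (1 / 4) = 4 * Real.pi by ring]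
  exact inv_mul_cancel₀ (by positivity)

theorem integrable_gaussProfile_one :
    Integrable fun z : EuclideanSpace ℝ (Fin d) => gaussProfile d 1 (‖z‖ ^ 2) :=
  Integrable.of_integral_ne_zero (by rw [integral_gaussProfile_one]; exact one_ne_zero)

theorem gaussProfile_scale {σ : ℝ} (hσ : 0 < σ) (r : ℝ) :
    gaussProfile d 1 r = Real.sqrt σ ^ d * gaussProfile d σ (σ * r) := by
  have h1 : Real.sqrt σ ^ d = σ ^ ((d : ℝ) / 2) := by
    rw [Real.sqrt_eq_rpow, ← Real.rpow_natCast, ← Real.rpow_mul hσ.le]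
    ring_nf
  rw [gaussProfile, gaussProfile, h1, Real.mul_rpow (by positivity) hσ.le, mul_one,
    Real.rpow_neg hσ.le]
  have h2 : σ * r / (4 * σ) = r / (4 * 1) := by field_simp
  have h3 : σ ^ ((d : ℝ) / 2) ≠ 0 := by positivity
  rw [h2]
  field_simp

/-- The substitution y = x + √σ z moves the dependence on σ from the kernel to the function, so that
dominated convergence runs against one fixed Gaussian. -/
theorem integral_gaussProfile_smul {F : Type*} [NormedAddCommGroup F] [NormedSpace ℝ F] {σ : ℝ}
    (hσ : 0 < σ) (x : EuclideanSpace ℝ (Fin d)) (w : EuclideanSpace ℝ (Fin d) → F) :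
    ∫ y, gaussProfile d σ (‖y - x‖ ^ 2) • w y =
      ∫ z, gaussProfile d 1 (‖z‖ ^ 2) • w (x + Real.sqrt σ • z) := by
  have hs : 0 < Real.sqrt σ := Real.sqrt_pos.2 hσ
  have h1 : ∀ z : EuclideanSpace ℝ (Fin d),
      gaussProfile d 1 (‖z‖ ^ 2) • w (x + Real.sqrt σ • z) =
        Real.sqrt σ ^ d • (fun y => gaussProfile d σ (‖y‖ ^ 2) • w (x + y)) (Real.sqrt σ • z) := by
    intro z
    have h2 : ‖Real.sqrt σ • z‖ ^ 2 = σ * ‖z‖ ^ 2 := by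
      rw [norm_smul, mul_pow, Real.norm_of_nonneg hs.le, Real.sq_sqrt hσ.le]
    rw [gaussProfile_scale hσ]
    simp only [h2, smul_smul]
  rw [integral_congr_ae (Eventually.of_forall h1), integral_smul,
    Measure.integral_comp_smul volume
      (fun y : EuclideanSpace ℝ (Fin d) => gaussProfile d σ (‖y‖ ^ 2) • w (x + y)),
    finrank_euclideanSpace_fin, abs_of_pos (by positivity), smul_smul,
    mul_inv_cancel₀ (by positivity), one_smul]
  rw [← integral_add_left_eq_self _ x]
  simp

theorem integral_gaussProfile {σ : ℝ} (hσ : 0 < σ) (x : EuclideanSpace ℝ (Fin d)) :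
    ∫ y, gaussProfile d σ (‖y - x‖ ^ 2) = 1 := by
  simpa [integral_gaussProfile_one] using integral_gaussProfile_smul hσ x fun _ => (1 : ℝ)

/-- The heat kernel is an approximate identity, uniformly for jointly continuous families of
compactly supported functions. -/
theorem tendsto_integral_gaussProfile_smul {ι : Type*} {l : Filter ι} [l.IsCountablyGenerated]
    {W : ℝ → EuclideanSpace ℝ (Fin d) → ℂ} {K : Set (EuclideanSpace ℝ (Fin d))} (hK : IsCompact K)
    (hW : ContinuousOn (fun p : ℝ × EuclideanSpace ℝ (Fin d) => W p.1 p.2) (Ioi 0 ×ˢ univ))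
    (hz : ∀ s, 0 < s → ∀ y ∉ K, W s y = 0) (x : EuclideanSpace ℝ (Fin d)) {τ : ℝ} (hτ : 0 < τ)
    {s σ : ι → ℝ} (hs : Tendsto s l (𝓝 τ)) (hσ : Tendsto σ l (𝓝[>] 0)) :
    Tendsto (fun i => ∫ y, gaussProfile d (σ i) (‖y - x‖ ^ 2) • W (s i) y) l (𝓝 (W τ x)) := by
  have hσ0 : ∀ᶠ i in l, 0 < σ i := hσ.eventually self_mem_nhdsWithin
  have hsτ : ∀ᶠ i in l, s i ∈ Icc (τ / 2) (2 * τ) :=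
    hs.eventually (Icc_mem_nhds (by linarith) (by linarith))
  -- The time `s i` moves as well, so the dominating constant must be uniform over a compact time
  -- interval around `τ`; off `K` the family vanishes.
  obtain ⟨M, hM⟩ := ((isCompact_Icc (a := τ / 2) (b := 2 * τ)).prod hK).exists_bound_of_continuousOn
    (hW.mono (prod_mono (fun r hr => lt_of_lt_of_le (by linarith) hr.1) (subset_univ _)))
  have hbd : ∀ r ∈ Icc (τ / 2) (2 * τ), ∀ y, ‖W r y‖ ≤ max M 0 := by
    intro r hr y
    by_cases hy : y ∈ K
    · exact (hM (r, y) ⟨hr, hy⟩).trans (le_max_left _ _)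
    · rw [hz r (lt_of_lt_of_le (by linarith) hr.1) y hy, norm_zero]
      exact le_max_right _ _
  have key : Tendsto (fun i => ∫ z : EuclideanSpace ℝ (Fin d),
      gaussProfile d 1 (‖z‖ ^ 2) • W (s i) (x + Real.sqrt (σ i) • z)) l
      (𝓝 (∫ z : EuclideanSpace ℝ (Fin d), gaussProfile d 1 (‖z‖ ^ 2) • W τ x)) := by
    refine tendsto_integral_filter_of_dominated_convergence
      (fun z => gaussProfile d 1 (‖z‖ ^ 2) * max M 0) ?_ ?_
      (integrable_gaussProfile_one.mul_const _) ?_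
    · filter_upwards [hsτ] with i hi
      have hc := continuous_slice hW (p := s i) (mem_Ioi.2 (lt_of_lt_of_le (by linarith) hi.1))
      refine (integrable_gaussProfile_one.aestronglyMeasurable).smul ?_
      exact (hc.comp (by fun_prop : Continuous fun z : EuclideanSpace ℝ (Fin d) =>
        x + Real.sqrt (σ i) • z)).aestronglyMeasurable
    · filter_upwards [hsτ] with i hi
      refine Eventually.of_forall fun z => ?_
      rw [norm_smul, Real.norm_of_nonneg (gaussProfile_pos one_pos _).le]
      exact mul_le_mul_of_nonneg_left (hbd _ hi _) (gaussProfile_pos one_pos _).le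
    · refine Eventually.of_forall fun z => Tendsto.const_smul ?_ _
      have hc : ContinuousAt (fun p : ℝ × EuclideanSpace ℝ (Fin d) => W p.1 p.2) (τ, x) :=
        hW.continuousAt (prod_mem_nhds (Ioi_mem_nhds hτ) univ_mem)
      have hsq : Tendsto (fun i => x + Real.sqrt (σ i) • z) l (𝓝 x) := by
        have h0 : Tendsto (fun i => Real.sqrt (σ i)) l (𝓝 0) := by
          have := (Real.continuous_sqrt.tendsto 0).comp (tendsto_nhds_of_tendsto_nhdsWithin hσ)
          simpa [Function.comp_def] using this
        simpa using tendsto_const_nhds.add (h0.smul_const z)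
      exact hc.tendsto.comp (hs.prodMk_nhds hsq)
  rw [integral_smul_const, integral_gaussProfile_one, one_smul] at key
  refine key.congr' ?_
  filter_upwards [hσ0] with i hi
  rw [integral_gaussProfile_smul hi]

/-- Attaching the cutoff to `u` instead of the Gaussian gives a globally continuous function, to
which the approximate identity applies. Both times vary because Duhamel's formula needs s → τ
together with σ = τ - s → 0. -/
theorem tendsto_integral_cutGauss_smul {ι : Type*} {l : Filter ι} [l.IsCountablyGenerated]
    {Ω : Set (EuclideanSpace ℝ (Fin d))} (hΩ : IsOpen Ω) {x : EuclideanSpace ℝ (Fin d)} {ρ : ℝ}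
    (hρ : 0 < ρ) (hball : Metric.closedBall x ρ ⊆ Ω) {η : ℝ → ℝ} (hη : ContDiff ℝ ∞ η)
    (h0 : ∀ r, ρ ^ 2 ≤ r → η r = 0) {u : ℝ → EuclideanSpace ℝ (Fin d) → ℂ}
    (hu : ContinuousOn (fun p : ℝ × EuclideanSpace ℝ (Fin d) => u p.1 p.2) (Ioi 0 ×ˢ Ω))
    {τ : ℝ} (hτ : 0 < τ)
    {s σ : ι → ℝ} (hs : Tendsto s l (𝓝 τ)) (hσ : Tendsto σ l (𝓝[>] 0)) :
    Tendsto (fun i => ∫ y, cutGauss η x (σ i) y • u (s i) y) l (𝓝 (η 0 • u τ x)) := by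
  have hz : ∀ y ∉ Metric.closedBall x ρ, η (‖y - x‖ ^ 2) = 0 := by
    intro y hy
    rw [Metric.mem_closedBall, dist_eq_norm, not_le] at hy
    exact h0 _ (by gcongr)
  have hηc := hη.continuous
  have hW := continuousOn_smul_of_eq_zero (S := Ioi (0 : ℝ)) hΩ Metric.isClosed_closedBall hball
    (g := fun _ y => η (‖y - x‖ ^ 2)) (by fun_prop) hu fun p _ y hy => hz y hy
  have := tendsto_integral_gaussProfile_smul (W := fun s y => η (‖y - x‖ ^ 2) • u s y)
    (isCompact_closedBall x ρ) hW (fun s _ y hy => by rw [hz y hy, zero_smul]) x hτ hs hσ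
  simp only [sub_self, norm_zero, ne_eq, OfNat.ofNat_ne_zero, not_false_eq_true, zero_pow] at this
  refine this.congr fun i => ?_
  simp only [cutGauss, smul_smul, mul_comm]

end ApproximateIdentity

/-! ### Duhamel's formula for weak solutions of the heat equation. -/

section Duhamel

variable {d : ℕ}

/-- `u` is continuous on `(0,∞) × Ω` and solves the heat equation there, tested against smooth
compactly supported functions of the space variable. -/
structure IsWeakHeatSolution (Ω : Set (EuclideanSpace ℝ (Fin d)))
    (u : ℝ → EuclideanSpace ℝ (Fin d) → ℂ) : Prop where
  continuousOn : ContinuousOn (fun p : ℝ × EuclideanSpace ℝ (Fin d) => u p.1 p.2) (Ioi 0 ×ˢ Ω)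
  integral_sub : ∀ ψ : EuclideanSpace ℝ (Fin d) → ℝ, ContDiff ℝ ∞ ψ → HasCompactSupport ψ →
    tsupport ψ ⊆ Ω → ∀ a b : ℝ, 0 < a → a ≤ b →
      (∫ y, ψ y • u b y) - ∫ y, ψ y • u a y = ∫ s in a..b, ∫ y, (Δ ψ) y • u s y

/-- The time derivative of `cutGauss`. -/
noncomputable def cutGaussTimeDeriv (η : ℝ → ℝ) (x : EuclideanSpace ℝ (Fin d)) (σ : ℝ)
    (y : EuclideanSpace ℝ (Fin d)) : ℝ :=
  η (‖y - x‖ ^ 2) *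
    ((‖y - x‖ ^ 2 / (4 * σ ^ 2) - d / (2 * σ)) * gaussProfile d σ (‖y - x‖ ^ 2))

theorem hasDerivAt_cutGauss (η : ℝ → ℝ) (x : EuclideanSpace ℝ (Fin d)) {σ : ℝ} (hσ : 0 < σ)
    (y : EuclideanSpace ℝ (Fin d)) :
    HasDerivAt (fun s => cutGauss η x s y) (cutGaussTimeDeriv η x σ y) σ :=
  (hasDerivAt_gaussProfile_time hσ _).const_mul _

theorem continuousOn_cutGaussTimeDeriv {η : ℝ → ℝ} (hη : ContDiff ℝ ∞ η)
    (x : EuclideanSpace ℝ (Fin d)) :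
    ContinuousOn (fun p : ℝ × EuclideanSpace ℝ (Fin d) => cutGaussTimeDeriv η x p.1 p.2)
      (Ioi 0 ×ˢ univ) := by
  have c := hη.continuous
  refine ContinuousOn.mul (by fun_prop) (ContinuousOn.mul (ContinuousOn.sub ?_ ?_)
    (continuousOn_gaussProfile_norm_sq x))
  · refine ContinuousOn.div (by fun_prop) (by fun_prop) fun p hp => ?_
    have : 0 < p.1 := hp.1
    positivity
  · refine ContinuousOn.div (by fun_prop) (by fun_prop) fun p hp => ?_
    have : 0 < p.1 := hp.1
    positivity

theorem cutGaussTimeDeriv_eq_zero {η : ℝ → ℝ} {ρ : ℝ} (hρ : 0 < ρ)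
    (h0 : ∀ r, ρ ^ 2 ≤ r → η r = 0)
    (x : EuclideanSpace ℝ (Fin d)) (σ : ℝ) {y : EuclideanSpace ℝ (Fin d)}
    (hy : y ∉ Metric.closedBall x ρ) : cutGaussTimeDeriv η x σ y = 0 := by
  rw [Metric.mem_closedBall, dist_eq_norm, not_le] at hy
  rw [cutGaussTimeDeriv, h0 _ (by gcongr), zero_mul]

section

variable {Ω : Set (EuclideanSpace ℝ (Fin d))} (hΩ : IsOpen Ω) {x : EuclideanSpace ℝ (Fin d)}
  {ρ : ℝ} (hρ : 0 < ρ) (hball : Metric.closedBall x ρ ⊆ Ω) {η : ℝ → ℝ} (hη : ContDiff ℝ ∞ η)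
  (h0 : ∀ r, ρ ^ 2 ≤ r → η r = 0) {u : ℝ → EuclideanSpace ℝ (Fin d) → ℂ}

include hΩ hball in
/-- Pairings of a continuous `u` with a continuous family of kernels supported in a ball depend
continuously on the two times. -/
theorem continuousOn_integral_kernel_smul
    (hu : ContinuousOn (fun p : ℝ × EuclideanSpace ℝ (Fin d) => u p.1 p.2) (Ioi 0 ×ˢ Ω))
    {q : ℝ → EuclideanSpace ℝ (Fin d) → ℝ}
    (hq : ContinuousOn (fun p : ℝ × EuclideanSpace ℝ (Fin d) => q p.1 p.2) (Ioi 0 ×ˢ univ))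
    (hqz : ∀ σ, 0 < σ → ∀ y ∉ Metric.closedBall x ρ, q σ y = 0) :
    ContinuousOn (fun p : ℝ × ℝ => ∫ y, q p.2 y • u p.1 y) (Ioi 0 ×ˢ Ioi 0) := by
  refine continuousOn_integral_smul hΩ (isCompact_closedBall x ρ) hball
    (g := fun p : ℝ × ℝ => q p.2) (u := fun p : ℝ × ℝ => u p.1) ?_ ?_
    fun p hp y hy => hqz _ hp.2 y hy
  · exact hq.comp (f := fun p : (ℝ × ℝ) × EuclideanSpace ℝ (Fin d) => (p.1.2, p.2))
      (by fun_prop) fun p hp => ⟨hp.1.2, trivial⟩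
  · exact hu.comp (f := fun p : (ℝ × ℝ) × EuclideanSpace ℝ (Fin d) => (p.1.1, p.2))
      (by fun_prop) fun p hp => ⟨hp.1.1, hp.2⟩

include hΩ hball in
theorem integrable_kernel_smul
    (hu : ContinuousOn (fun p : ℝ × EuclideanSpace ℝ (Fin d) => u p.1 p.2) (Ioi 0 ×ˢ Ω))
    {q : ℝ → EuclideanSpace ℝ (Fin d) → ℝ}
    (hq : ContinuousOn (fun p : ℝ × EuclideanSpace ℝ (Fin d) => q p.1 p.2) (Ioi 0 ×ˢ univ))
    (hqz : ∀ σ, 0 < σ → ∀ y ∉ Metric.closedBall x ρ, q σ y = 0) {s σ : ℝ} (hs : 0 < s)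
    (hσ : 0 < σ) : Integrable fun y => q σ y • u s y := by
  have hus : ContinuousOn (fun p : ℝ × EuclideanSpace ℝ (Fin d) => u s p.2) (Ioi 0 ×ˢ Ω) :=
    hu.comp (f := fun p : ℝ × EuclideanSpace ℝ (Fin d) => (s, p.2)) (by fun_prop)
      fun p hp => ⟨hs, hp.2⟩
  exact integrable_slice (S := Ioi 0) (p := σ) (W := fun σ y => q σ y • u s y)
    (isCompact_closedBall x ρ)
    (continuousOn_smul_of_eq_zero (u := fun _ : ℝ => u s) hΩ Metric.isClosed_closedBall hball
      hq hus hqz) hσ fun y hy => by rw [hqz σ hσ y hy, zero_smul]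

include hΩ hball hρ hη h0 in
theorem hasDerivAt_integral_cutGauss_smul_right
    (hu : ContinuousOn (fun p : ℝ × EuclideanSpace ℝ (Fin d) => u p.1 p.2) (Ioi 0 ×ˢ Ω))
    {s σ : ℝ} (hs : 0 < s) (hσ : 0 < σ) :
    HasDerivAt (fun σ => ∫ y, cutGauss η x σ y • u s y)
      (∫ y, cutGaussTimeDeriv η x σ y • u s y) σ := by
  have hK := isCompact_closedBall x ρ
  have hus : ContinuousOn (fun p : ℝ × EuclideanSpace ℝ (Fin d) => u s p.2) (Ioi 0 ×ˢ Ω) :=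
    hu.comp (f := fun p : ℝ × EuclideanSpace ℝ (Fin d) => (s, p.2)) (by fun_prop)
      fun p hp => ⟨hs, hp.2⟩
  have hc1 := continuousOn_smul_of_eq_zero (u := fun _ : ℝ => u s) hΩ hK.isClosed hball
    (continuousOn_cutGauss hη x) hus fun p _ y hy => cutGauss_eq_zero hρ h0 x p hy
  have hc2 := continuousOn_smul_of_eq_zero (u := fun _ : ℝ => u s) hΩ hK.isClosed hball
    (continuousOn_cutGaussTimeDeriv hη x) hus fun p _ y hy => cutGaussTimeDeriv_eq_zero hρ h0 x p hy
  have hsub : Icc (σ / 2) (2 * σ) ⊆ Ioi 0 := fun r hr => lt_of_lt_of_le (by linarith) hr.1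
  obtain ⟨M, hM⟩ := ((isCompact_Icc (a := σ / 2) (b := 2 * σ)).prod hK).exists_bound_of_continuousOn
    (hc2.mono (prod_mono hsub (subset_univ _)))
  refine (hasDerivAt_integral_of_dominated_loc_of_deriv_le
    (F := fun σ y => cutGauss η x σ y • u s y) (F' := fun σ y => cutGaussTimeDeriv η x σ y • u s y)
    (s := Icc (σ / 2) (2 * σ)) (bound := (Metric.closedBall x ρ).indicator fun _ => M)
    (Icc_mem_nhds (by linarith) (by linarith)) ?_ ?_ ?_ ?_ ?_ ?_).2
  · filter_upwards [Ioi_mem_nhds hσ] with r hr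
    exact (continuous_slice (W := fun σ y => cutGauss η x σ y • u s y) hc1
      hr).aestronglyMeasurable
  · exact integrable_slice (W := fun σ y => cutGauss η x σ y • u s y) hK hc1 hσ
      fun y hy => by rw [cutGauss_eq_zero hρ h0 x σ hy, zero_smul]
  · exact (continuous_slice (W := fun σ y => cutGaussTimeDeriv η x σ y • u s y) hc2
      hσ).aestronglyMeasurable
  · refine Eventually.of_forall fun y r hr => ?_
    by_cases hy : y ∈ Metric.closedBall x ρ
    · rw [indicator_of_mem hy]
      exact hM (r, y) ⟨hr, hy⟩
    · rw [indicator_of_notMem hy, cutGaussTimeDeriv_eq_zero hρ h0 x r hy, zero_smul, norm_zero]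
  · exact (integrable_indicator_iff Metric.isClosed_closedBall.measurableSet).2
      (integrableOn_const hK.measure_ne_top)
  · exact Eventually.of_forall fun y r hr => (hasDerivAt_cutGauss η x (hsub hr) y).smul_const _

include hball in
-- The fundamental theorem of calculus for the integrated equation, based at s/2 to stay away from
-- time 0.
theorem IsWeakHeatSolution.hasDerivAt_integral (hu : IsWeakHeatSolution Ω u)
    {ψ : EuclideanSpace ℝ (Fin d) → ℝ} (hψ : ContDiff ℝ ∞ ψ)
    (hsupp : tsupport ψ ⊆ Metric.closedBall x ρ)
    (hc : ContinuousOn (fun s => ∫ y, (Δ ψ) y • u s y) (Ioi 0)) {s : ℝ} (hs : 0 < s) :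
    HasDerivAt (fun s => ∫ y, ψ y • u s y) (∫ y, (Δ ψ) y • u s y) s := by
  have hcs : HasCompactSupport ψ :=
    HasCompactSupport.of_support_subset_isCompact (isCompact_closedBall x ρ)
      (subset_closure.trans hsupp)
  have hs2 : 0 < s / 2 := by linarith
  have hmem : uIcc (s / 2) s ⊆ Ioi 0 := by
    rw [uIcc_of_le (by linarith)]
    exact fun r hr => lt_of_lt_of_le hs2 hr.1
  have hd := intervalIntegral.integral_hasDerivAt_right
    ((hc.mono hmem).intervalIntegrable)
    (hc.stronglyMeasurableAtFilter isOpen_Ioi s hs) (hc.continuousAt (Ioi_mem_nhds hs))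
  refine (hd.add_const (∫ y, ψ y • u (s / 2) y)).congr_of_eventuallyEq ?_
  filter_upwards [Ioi_mem_nhds (show s / 2 < s by linarith)] with r hr
  rw [← hu.integral_sub ψ hψ hcs (hsupp.trans hball) (s / 2) r hs2 (le_of_lt hr)]
  ring

include hΩ hball hρ hη h0 in
/-- Duhamel's formula in differential form. -/
theorem IsWeakHeatSolution.hasDerivAt_integral_cutGauss (hu : IsWeakHeatSolution Ω u)
    {τ s : ℝ} (hs : 0 < s) (hsτ : s < τ) :
    HasDerivAt (fun s => ∫ y, cutGauss η x (τ - s) y • u s y)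
      (∫ y, cutGaussCommutator η x (τ - s) y • u s y) s := by
  have hK := isCompact_closedBall x ρ
  have hcu := hu.continuousOn
  have hcomm := continuousOn_integral_kernel_smul hΩ hball hcu
    (continuousOn_cutGaussCommutator hη x)
    fun σ _ y hy => cutGaussCommutator_eq_zero hρ h0 x σ hy
  have htime := continuousOn_integral_kernel_smul hΩ hball hcu
    (continuousOn_cutGaussTimeDeriv hη x) fun σ _ y hy => cutGaussTimeDeriv_eq_zero hρ h0 x σ hy
  have hint1 : ∀ s σ, 0 < s → 0 < σ → Integrable fun y => cutGaussCommutator η x σ y • u s y :=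
    fun s σ hs hσ => integrable_kernel_smul hΩ hball hcu (continuousOn_cutGaussCommutator hη x)
      (fun σ _ y hy => cutGaussCommutator_eq_zero hρ h0 x σ hy) hs hσ
  have hint2 : ∀ s σ, 0 < s → 0 < σ → Integrable fun y => cutGaussTimeDeriv η x σ y • u s y :=
    fun s σ hs hσ => integrable_kernel_smul hΩ hball hcu (continuousOn_cutGaussTimeDeriv hη x)
      (fun σ _ y hy => cutGaussTimeDeriv_eq_zero hρ h0 x σ hy) hs hσ
  have hlap : ∀ s σ, 0 < s → 0 < σ → ∫ y, (Δ (cutGauss η x σ)) y • u s y =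
      (∫ y, cutGaussCommutator η x σ y • u s y) + ∫ y, cutGaussTimeDeriv η x σ y • u s y := by
    intro s σ hs hσ
    rw [← integral_add (hint1 s σ hs hσ) (hint2 s σ hs hσ)]
    refine integral_congr_ae (Eventually.of_forall fun y => ?_)
    simp only [laplacian_cutGauss hη hσ x y, ← add_smul]
    rfl
  have hlapc : ContinuousOn (fun p : ℝ × ℝ => ∫ y, (Δ (cutGauss η x p.2)) y • u p.1 y)
      (Ioi 0 ×ˢ Ioi 0) :=
    (hcomm.add htime).congr fun p hp => hlap p.1 p.2 hp.1 hp.2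
  have hopen : ∀ v : ℝ × ℝ, v ∈ Ioi (0 : ℝ) ×ˢ Ioi (0 : ℝ) → Ioi (0 : ℝ) ×ˢ Ioi (0 : ℝ) ∈ 𝓝 v :=
    fun v hv => (isOpen_Ioi.prod isOpen_Ioi).mem_nhds hv
  have hv0 : ((s, τ - s) : ℝ × ℝ) ∈ Ioi (0 : ℝ) ×ˢ Ioi (0 : ℝ) := ⟨hs, sub_pos.2 hsτ⟩
  have hd1 : ∀ v : ℝ × ℝ, v ∈ Ioi (0 : ℝ) ×ˢ Ioi (0 : ℝ) →
      HasDerivAt (fun s => ∫ y, cutGauss η x v.2 y • u s y)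
        (∫ y, (Δ (cutGauss η x v.2)) y • u v.1 y) v.1 := by
    intro v hv
    refine hu.hasDerivAt_integral hball (contDiff_cutGauss hη x v.2)
      (tsupport_cutGauss_subset hρ h0 x v.2) ?_ hv.1
    exact hlapc.comp (f := fun r : ℝ => (r, v.2)) (by fun_prop) fun r hr => ⟨hr, hv.2⟩
  have hd2 : ∀ v : ℝ × ℝ, v ∈ Ioi (0 : ℝ) ×ˢ Ioi (0 : ℝ) →
      HasDerivAt (fun σ => ∫ y, cutGauss η x σ y • u v.1 y)
        (∫ y, cutGaussTimeDeriv η x v.2 y • u v.1 y) v.2 := fun v hv =>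
    hasDerivAt_integral_cutGauss_smul_right hΩ hρ hball hη h0 hcu hv.1 hv.2
  -- As a function of two independent times the pairing has continuous partial derivatives, hence is
  -- differentiable. The chain rule along s ↦ (s, τ - s) subtracts the time derivative of the kernel
  -- from its Laplacian, leaving the commutator.
  have hstrict := hasStrictFDerivAt_uncurry_coprod (𝕜 := ℝ) (u := (s, τ - s))
    (f := fun s σ => ∫ y, cutGauss η x σ y • u s y)
    (f₁ := fun s σ => ContinuousLinearMap.toSpanSingleton ℝ
      (∫ y, (Δ (cutGauss η x σ)) y • u s y))
    (f₂ := fun s σ => ContinuousLinearMap.toSpanSingleton ℝ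
      (∫ y, cutGaussTimeDeriv η x σ y • u s y))
    (by filter_upwards [hopen _ hv0] with v hv using (hd1 v hv).hasFDerivAt)
    (by filter_upwards [hopen _ hv0] with v hv using (hd2 v hv).hasFDerivAt)
    ((ContinuousLinearMap.toSpanSingletonCLE (𝕜 := ℝ) (E := ℂ)).continuous.continuousAt.comp
      (hlapc.continuousAt (hopen _ hv0)))
    ((ContinuousLinearMap.toSpanSingletonCLE (𝕜 := ℝ) (E := ℂ)).continuous.continuousAt.comp
      (htime.continuousAt (hopen _ hv0)))
  have hpath : HasDerivAt (fun s : ℝ => (s, τ - s)) ((1 : ℝ), (-1 : ℝ)) s :=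
    (hasDerivAt_id s).prodMk ((hasDerivAt_id s).const_sub τ)
  have := hstrict.hasFDerivAt.comp_hasDerivAt s hpath
  refine this.congr_deriv ?_
  rw [ContinuousLinearMap.coprod_apply]
  change (1 : ℝ) • (∫ y, (Δ (cutGauss η x (τ - s))) y • u s y) +
    (-1 : ℝ) • (∫ y, cutGaussTimeDeriv η x (τ - s) y • u s y) = _
  rw [hlap s (τ - s) hs (sub_pos.2 hsτ)]
  module

include hΩ hball hρ hη h0 in
/-- The shift of the time argument in the kernel is negligible at time `0`, as long as the local
`L¹` norms of `u` stay bounded. -/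
theorem tendsto_integral_cutGauss_initial
    (hu : ContinuousOn (fun p : ℝ × EuclideanSpace ℝ (Fin d) => u p.1 p.2) (Ioi 0 ×ˢ Ω))
    {τ : ℝ} (hτ : 0 < τ) {M : ℝ}
    (hM : ∀ s, 0 < s → s ≤ τ → ∫ y in Metric.closedBall x ρ, ‖u s y‖ ≤ M) {L : ℂ}
    (hL : Tendsto (fun a => ∫ y, cutGauss η x τ y • u a y) (𝓝[>] 0) (𝓝 L)) :
    Tendsto (fun a => ∫ y, cutGauss η x (τ - a) y • u a y) (𝓝[>] 0) (𝓝 L) := by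
  have hK := isCompact_closedBall x ρ
  have hint : ∀ s σ, 0 < s → 0 < σ → Integrable fun y => cutGauss η x σ y • u s y :=
    fun s σ hs hσ => integrable_kernel_smul hΩ hball hu (continuousOn_cutGauss hη x)
      (fun σ _ y hy => cutGauss_eq_zero hρ h0 x σ hy) hs hσ
  have hdiff : Tendsto (fun a => (∫ y, cutGauss η x (τ - a) y • u a y) -
      ∫ y, cutGauss η x τ y • u a y) (𝓝[>] 0) (𝓝 0) := by
    rw [Metric.tendsto_nhds]
    intro ε hε
    have hM0 : 0 ≤ M := (integral_nonneg fun _ => norm_nonneg _).trans (hM τ hτ le_rfl)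
    have hε' : 0 < ε / (M + 1) := by positivity
    -- By compactness of the ball, the kernel at time σ tends to the kernel at time τ uniformly in
    -- space as σ → τ; the bounded L¹ norms then suffice. The +1 in M + 1 only avoids dividing by
    -- zero.
    obtain ⟨v, hv, hv2⟩ := hK.mem_uniformity_of_prod (f := cutGauss η x) (s := Ioi 0) (q := τ)
      ((continuousOn_cutGauss hη x).mono (prod_mono_right (subset_univ _))) hτ
      (Metric.dist_mem_uniformity hε')
    have hv3 : v ∈ 𝓝 τ := by rwa [(isOpen_Ioi.nhdsWithin_eq hτ)] at hv
    have hsub : Tendsto (fun a : ℝ => τ - a) (𝓝[>] 0) (𝓝 τ) := by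
      have : Tendsto (fun a : ℝ => τ - a) (𝓝 0) (𝓝 (τ - 0)) := (by fun_prop : Continuous _).tendsto 0
      rw [sub_zero] at this
      exact this.mono_left nhdsWithin_le_nhds
    filter_upwards [hsub.eventually hv3, self_mem_nhdsWithin,
      Ioo_mem_nhdsGT hτ] with a ha ha0 haτ
    have ha0' : 0 < a := ha0
    rw [dist_zero_right, ← integral_sub (hint a _ ha0' (sub_pos.2 haτ.2)) (hint a τ ha0' hτ)]
    have hcont : ContinuousOn (u a) (Metric.closedBall x ρ) :=
      hu.comp (f := fun y => (a, y)) (by fun_prop) fun y hy => ⟨ha0, hball hy⟩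
    have hui : IntegrableOn (fun y => ‖u a y‖) (Metric.closedBall x ρ) :=
      hcont.norm.integrableOn_compact hK
    calc ‖∫ y, (cutGauss η x (τ - a) y • u a y - cutGauss η x τ y • u a y)‖
        ≤ ∫ y, (Metric.closedBall x ρ).indicator (fun y => ε / (M + 1) * ‖u a y‖) y := by
          refine norm_integral_le_of_norm_le ?_ (Eventually.of_forall fun y => ?_)
          · exact (integrable_indicator_iff Metric.isClosed_closedBall.measurableSet).2
              (hui.const_mul _)
          · by_cases hy : y ∈ Metric.closedBall x ρ
            · rw [indicator_of_mem hy, ← sub_smul, norm_smul]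
              gcongr
              exact (hv2 _ ha y hy).le
            · rw [indicator_of_notMem hy, cutGauss_eq_zero hρ h0 x _ hy,
                cutGauss_eq_zero hρ h0 x _ hy]
              simp
      _ = ε / (M + 1) * ∫ y in Metric.closedBall x ρ, ‖u a y‖ := by
          rw [integral_indicator Metric.isClosed_closedBall.measurableSet, integral_const_mul]
      _ ≤ ε / (M + 1) * M := by
          gcongr
          exact hM a ha0' haτ.2.le
      _ < ε := by
          rw [div_mul_eq_mul_div, div_lt_iff₀ (by positivity)]
          nlinarith
  simpa using hdiff.add hL

include hΩ hball hρ hη h0 in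
/-- Comparison of a weak solution of the heat equation at `(τ, x)` with the localized free
evolution of its initial value: the error is controlled by the commutator term. -/
theorem IsWeakHeatSolution.norm_sub_le (hη0 : η 0 = 1) (hu : IsWeakHeatSolution Ω u)
    {τ : ℝ} (hτ : 0 < τ) {M : ℝ}
    (hM : ∀ s, 0 < s → s ≤ τ → ∫ y in Metric.closedBall x ρ, ‖u s y‖ ≤ M) {L : ℂ}
    (hL : Tendsto (fun a => ∫ y, cutGauss η x τ y • u a y) (𝓝[>] 0) (𝓝 L))
    {β : ℝ → ℝ} (hβ : ContinuousOn β (Icc 0 τ)) (hβ0 : ∀ s ∈ Icc 0 τ, 0 ≤ β s)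
    (hbound : ∀ s ∈ Ioo 0 τ, ‖∫ y, cutGaussCommutator η x (τ - s) y • u s y‖ ≤ β s) :
    ‖u τ x - L‖ ≤ ∫ s in (0 : ℝ)..τ, β s := by
  have hF0 := tendsto_integral_cutGauss_initial hΩ hρ hball hη h0 hu.continuousOn hτ hM hL
  have hFτ : Tendsto (fun s => ∫ y, cutGauss η x (τ - s) y • u s y) (𝓝[<] τ) (𝓝 (u τ x)) := by
    have hσ : Tendsto (fun s : ℝ => τ - s) (𝓝[<] τ) (𝓝[>] 0) := by
      refine tendsto_nhdsWithin_iff.2 ⟨?_, ?_⟩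
      · have : Tendsto (fun a : ℝ => τ - a) (𝓝 τ) (𝓝 (τ - τ)) := (by fun_prop : Continuous _).tendsto τ
        rw [sub_self] at this
        exact this.mono_left nhdsWithin_le_nhds
      · filter_upwards [self_mem_nhdsWithin] with s hs using sub_pos.2 (mem_Iio.1 hs)
    have := tendsto_integral_cutGauss_smul hΩ hρ hball hη h0 hu.continuousOn hτ
      (l := 𝓝[<] τ) (s := fun s => s) (tendsto_id.mono_right nhdsWithin_le_nhds) hσ
    rwa [hη0, one_smul] at this
  -- The formula holds only for 0 < s < τ: `u` is not controlled pointwise at 0 and the Gaussian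
  -- degenerates at τ. So it is integrated over [a, b], and then a → 0 and b → τ.
  have hkey : ∀ a b, 0 < a → a ≤ b → b < τ →
      ‖(∫ y, cutGauss η x (τ - b) y • u b y) - ∫ y, cutGauss η x (τ - a) y • u a y‖ ≤
        ∫ s in (0 : ℝ)..τ, β s := by
    intro a b ha hab hb
    have hmem : ∀ s ∈ uIcc a b, 0 < s ∧ s < τ := by
      intro s hs
      rw [uIcc_of_le hab] at hs
      exact ⟨ha.trans_le hs.1, hs.2.trans_lt hb⟩
    have hcomm := continuousOn_integral_kernel_smul hΩ hball hu.continuousOn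
      (continuousOn_cutGaussCommutator hη x)
      fun σ _ y hy => cutGaussCommutator_eq_zero hρ h0 x σ hy
    have hc : ContinuousOn (fun s => ∫ y, cutGaussCommutator η x (τ - s) y • u s y) (uIcc a b) :=
      hcomm.comp (f := fun s => (s, τ - s)) (by fun_prop)
        fun s hs => ⟨(hmem s hs).1, sub_pos.2 (hmem s hs).2⟩
    rw [← intervalIntegral.integral_eq_sub_of_hasDerivAt (fun s hs =>
      hu.hasDerivAt_integral_cutGauss hΩ hρ hball hη h0 (hmem s hs).1 (hmem s hs).2)
      hc.intervalIntegrable]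
    have hβi : IntegrableOn β (Ioc 0 τ) :=
      (hβ.integrableOn_compact isCompact_Icc).mono_set Ioc_subset_Icc_self
    refine (intervalIntegral.norm_integral_le_of_norm_le hab (g := β)
      (Eventually.of_forall fun s hs => hbound s ⟨ha.trans hs.1, hs.2.trans_lt hb⟩) ?_).trans ?_
    · refine (intervalIntegrable_iff_integrableOn_Ioc_of_le hab).2 (hβi.mono_set ?_)
      exact Ioc_subset_Ioc ha.le hb.le
    · refine intervalIntegral.integral_mono_interval ha.le hab hb.le ?_ ?_
      · exact (ae_restrict_mem measurableSet_Ioc).mono fun s hs => hβ0 s ⟨hs.1.le, hs.2⟩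
      · exact (intervalIntegrable_iff_integrableOn_Ioc_of_le hτ.le).2 hβi
  have hstep : ∀ b, 0 < b → b < τ →
      ‖(∫ y, cutGauss η x (τ - b) y • u b y) - L‖ ≤ ∫ s in (0 : ℝ)..τ, β s := by
    intro b hb hbτ
    refine le_of_tendsto (tendsto_const_nhds.sub hF0).norm ?_
    filter_upwards [Ioo_mem_nhdsGT hb] with a ha
    exact hkey a b ha.1 ha.2.le hbτ
  refine le_of_tendsto (hFτ.sub_const L).norm ?_
  filter_upwards [Ioo_mem_nhdsLT hτ] with b hb
  exact hstep b hb.1 hb.2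

end

end Duhamel

/-! ### Test functions as elements of L²(Ω) and of the domain of H. -/

section TestFunctions

variable {d : ℕ}

theorem continuous_laplacian {ψ : EuclideanSpace ℝ (Fin d) → ℝ} (hψ : ContDiff ℝ ∞ ψ) :
    Continuous (Δ ψ) := by
  rw [InnerProductSpace.laplacian_eq_iteratedFDeriv_orthonormalBasis _
    (EuclideanSpace.basisFun (Fin d) ℝ)]
  have h : Continuous (iteratedFDeriv ℝ 2 ψ) :=
    hψ.continuous_iteratedFDeriv (m := 2) ENat.LEInfty.out
  fun_prop

theorem laplacian_eq_zero_of_notMem_tsupport {ψ : EuclideanSpace ℝ (Fin d) → ℝ}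
    {y : EuclideanSpace ℝ (Fin d)} (hy : y ∉ tsupport ψ) : (Δ ψ) y = 0 := by
  have h : ψ =ᶠ[𝓝 y] fun _ => (0 : ℝ) := notMem_tsupport_iff_eventuallyEq.1 hy
  rw [(InnerProductSpace.laplacian_congr_nhds h).self_of_nhds]
  exact congrFun InnerProductSpace.laplacian_const y

theorem hasCompactSupport_laplacian {ψ : EuclideanSpace ℝ (Fin d) → ℝ}
    (hs : HasCompactSupport ψ) : HasCompactSupport (Δ ψ) :=
  HasCompactSupport.intro hs fun _ hy => laplacian_eq_zero_of_notMem_tsupport hy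

theorem tsupport_laplacian_subset (ψ : EuclideanSpace ℝ (Fin d) → ℝ) :
    tsupport (Δ ψ) ⊆ tsupport ψ :=
  closure_minimal (fun y hy => by
    by_contra hc
    exact hy (laplacian_eq_zero_of_notMem_tsupport hc)) (isClosed_tsupport ψ)

/-- A real-valued continuous compactly supported function as an element of `L²(Ω)`. -/
noncomputable def testLp (Ω : Set (EuclideanSpace ℝ (Fin d)))
    (ψ : EuclideanSpace ℝ (Fin d) → ℝ) (hψ : Continuous ψ) (hs : HasCompactSupport ψ) : L2 Ω :=
  MemLp.toLp (fun y => (ψ y : ℂ))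
    ((Complex.continuous_ofReal.comp hψ).memLp_of_hasCompactSupport
      (hs.comp_left (g := fun r : ℝ => (r : ℂ)) Complex.ofReal_zero))

theorem coeFn_testLp (Ω : Set (EuclideanSpace ℝ (Fin d)))
    (ψ : EuclideanSpace ℝ (Fin d) → ℝ) (hψ : Continuous ψ) (hs : HasCompactSupport ψ) :
    testLp Ω ψ hψ hs =ᵐ[volume.restrict Ω] fun y => (ψ y : ℂ) :=
  MemLp.coeFn_toLp _

/-- Because `ψ` is real, the conjugation in the first slot disappears and the inner product becomes
the bilinear pairing used in `IsWeakHeatSolution`. -/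
theorem inner_testLp_eq {Ω : Set (EuclideanSpace ℝ (Fin d))}
    {ψ : EuclideanSpace ℝ (Fin d) → ℝ} (hψ : Continuous ψ) (hs : HasCompactSupport ψ)
    (hsupp : tsupport ψ ⊆ Ω) {f : L2 Ω} {w : EuclideanSpace ℝ (Fin d) → ℂ}
    (hf : f =ᵐ[volume.restrict Ω] w) :
    inner ℂ (testLp Ω ψ hψ hs) f = ∫ y, ψ y • w y := by
  have h0 : ∫ y in Ω, ψ y • w y = ∫ y, ψ y • w y :=
    setIntegral_eq_integral_of_forall_compl_eq_zero fun y hy => by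
      rw [image_eq_zero_of_notMem_tsupport fun h => hy (hsupp h), zero_smul]
  rw [L2.inner_def, ← h0]
  refine integral_congr_ae ?_
  filter_upwards [coeFn_testLp Ω ψ hψ hs, hf] with y h1 h2
  rw [h1, h2]
  simp [mul_comm]

theorem mem_graph_testLp {Ω : Set (EuclideanSpace ℝ (Fin d))} {H : L2 Ω →ₗ.[ℂ] L2 Ω}
    (hH : IsNonnegSelfAdjointExtension Ω H) {ψ : EuclideanSpace ℝ (Fin d) → ℝ}
    (hψ : ContDiff ℝ ∞ ψ) (hs : HasCompactSupport ψ) (hsupp : tsupport ψ ⊆ Ω) :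
    (testLp Ω ψ hψ.continuous hs,
      -testLp Ω (Δ ψ) (continuous_laplacian hψ) (hasCompactSupport_laplacian hs)) ∈ H.graph := by
  have hψ' : ContDiff ℝ ∞ (fun y => (ψ y : ℂ)) := Complex.ofRealCLM.contDiff.comp hψ
  refine hH.extends_neg_laplacian (fun y => (ψ y : ℂ)) hψ'
    (hs.comp_left (g := fun r : ℝ => (r : ℂ)) Complex.ofReal_zero)
    ((closure_mono fun y hy => ?_).trans hsupp) _ _ (coeFn_testLp Ω ψ hψ.continuous hs) ?_
  · intro h0
    exact hy (by simp [h0])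
  · filter_upwards [Lp.coeFn_neg (testLp Ω (Δ ψ) (continuous_laplacian hψ)
      (hasCompactSupport_laplacian hs)), coeFn_testLp Ω (Δ ψ) (continuous_laplacian hψ)
      (hasCompactSupport_laplacian hs)] with y h1 h2
    rw [h1, Pi.neg_apply, h2]
    have := (hψ.contDiffAt (x := y)).of_le (m := 2) ENat.LEInfty.out
      |>.laplacian_CLM_comp_left (l := Complex.ofRealCLM)
    exact congrArg Neg.neg this.symm

end TestFunctions

/-! ### Differentiating the semigroup on the domain of its generator. -/

section Semigroup

variable {d : ℕ} {Ω : Set (EuclideanSpace ℝ (Fin d))} {H : L2 Ω →ₗ.[ℂ] L2 Ω}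
  {S : ℝ → L2 Ω →L[ℂ] L2 Ω}

theorem inner_graph_symm (hH : IsSelfAdjoint H) {u v u' v' : L2 Ω} (h : (u, v) ∈ H.graph)
    (h' : (u', v') ∈ H.graph) : inner ℂ v u' = inner ℂ u v' := by
  have hadj := LinearPMap.adjoint_isFormalAdjoint hH.dense_domain
  rw [LinearPMap.isSelfAdjoint_def.1 hH] at hadj
  obtain ⟨a, rfl, rfl⟩ := (LinearPMap.mem_graph_iff H).1 h
  obtain ⟨b, rfl, rfl⟩ := (LinearPMap.mem_graph_iff H).1 h'
  exact hadj a b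

/-- `S s` commutes with the difference quotients that define the generator, and is continuous. -/
theorem IsSemigroupGeneratedByNeg.mem_graph (hS : IsSemigroupGeneratedByNeg H S) {f g : L2 Ω}
    (hfg : (f, g) ∈ H.graph) {s : ℝ} (hs : 0 ≤ s) : (S s f, S s g) ∈ H.graph := by
  rw [hS.generator] at hfg ⊢
  refine (((S s).continuous.tendsto g).comp hfg).congr' ?_
  filter_upwards [self_mem_nhdsWithin] with t ht
  have ht' : (0 : ℝ) ≤ t := le_of_lt ht
  have h1 : S t (S s f) = S s (S t f) := by
    have e1 := hS.add t s ht' hs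
    have e2 := hS.add s t hs ht'
    rw [add_comm, e2] at e1
    exact (congrArg (fun T : L2 Ω →L[ℂ] L2 Ω => T f) e1).symm
  simp only [Function.comp_apply]
  rw [h1, ← map_sub]
  exact ((S s).restrictScalars ℝ).map_smul t⁻¹ (f - S t f)

/-- The definition of the generator yields right derivatives directly. Together with strong
continuity they are enough for the fundamental theorem of calculus in `inner_sub_eq_integral`. -/
theorem IsSemigroupGeneratedByNeg.hasDerivWithinAt (hS : IsSemigroupGeneratedByNeg H S)
    {f g : L2 Ω} (hfg : (f, g) ∈ H.graph) {s : ℝ} (hs : 0 ≤ s) :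
    HasDerivWithinAt (fun s => S s f) (-(S s g)) (Ioi s) s := by
  rw [hasDerivWithinAt_iff_tendsto_slope' (by simp)]
  have h := (hS.generator _ _).1 (hS.mem_graph hfg hs)
  have hshift : Tendsto (fun r : ℝ => r - s) (𝓝[>] s) (𝓝[>] 0) := by
    refine tendsto_nhdsWithin_iff.2 ⟨?_, ?_⟩
    · have : Tendsto (fun a : ℝ => a - s) (𝓝 s) (𝓝 (s - s)) :=
        (by fun_prop : Continuous _).tendsto s
      rw [sub_self] at this
      exact this.mono_left nhdsWithin_le_nhds
    · filter_upwards [self_mem_nhdsWithin] with r hr using sub_pos.2 (mem_Ioi.1 hr)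
  refine (h.comp hshift).neg.congr' ?_
  filter_upwards [self_mem_nhdsWithin] with r hr
  have e := hS.add (r - s) s (sub_nonneg.2 (le_of_lt hr)) hs
  rw [sub_add_cancel] at e
  rw [slope_def_module, e]
  simp only [Function.comp_apply, ContinuousLinearMap.comp_apply]
  rw [← smul_neg, neg_sub]

theorem IsSemigroupGeneratedByNeg.inner_sub_eq_integral (hS : IsSemigroupGeneratedByNeg H S)
    (h : L2 Ω) {f g : L2 Ω} (hfg : (f, g) ∈ H.graph) {a b : ℝ} (ha : 0 ≤ a) (hab : a ≤ b) :
    inner ℂ h (S b f) - inner ℂ h (S a f) = ∫ s in a..b, inner ℂ h (S s (-g)) := by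
  have hsub : uIcc a b ⊆ Ici 0 := by
    rw [uIcc_of_le hab]
    exact fun r hr => ha.trans hr.1
  have hc : ∀ f : L2 Ω, ContinuousOn (fun s => inner ℂ h (S s f)) (uIcc a b) := fun f =>
    (continuousOn_const.inner (hS.strongly_continuous f)).mono hsub
  refine (intervalIntegral.integral_eq_sub_of_hasDeriv_right (hc f) (fun s hs => ?_)
    (hc (-g)).intervalIntegrable).symm
  rw [min_eq_left hab, max_eq_right hab] at hs
  have hd := hS.hasDerivWithinAt hfg (ha.trans hs.1.le)
  rw [map_neg]
  exact ((innerSL ℂ h).restrictScalars ℝ).hasFDerivAt.comp_hasDerivWithinAt s hd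

end Semigroup

/-! ### The heat kernel as a weak solution of the heat equation. -/

section HeatKernel

variable {d : ℕ} {Ω : Set (EuclideanSpace ℝ (Fin d))} {H : L2 Ω →ₗ.[ℂ] L2 Ω}
  {S : ℝ → L2 Ω →L[ℂ] L2 Ω}
  {k : ℝ → EuclideanSpace ℝ (Fin d) → EuclideanSpace ℝ (Fin d) → ℂ}

/-- The function `(s, y) ↦ ∫ k(s,y,z) φ(z) dz`. -/
noncomputable def kernelAction
    (k : ℝ → EuclideanSpace ℝ (Fin d) → EuclideanSpace ℝ (Fin d) → ℂ)
    (φ : EuclideanSpace ℝ (Fin d) → ℝ) (s : ℝ) (y : EuclideanSpace ℝ (Fin d)) : ℂ :=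
  ∫ z, φ z • k s y z

/-- `k` represents the operators `S t`, `t > 0`. -/
structure RepresentsSemigroup (S : ℝ → L2 Ω →L[ℂ] L2 Ω)
    (k : ℝ → EuclideanSpace ℝ (Fin d) → EuclideanSpace ℝ (Fin d) → ℂ) : Prop where
  isOpen : IsOpen Ω
  continuousOn : ContinuousOn
    (fun p : ℝ × EuclideanSpace ℝ (Fin d) × EuclideanSpace ℝ (Fin d) => k p.1 p.2.1 p.2.2)
    (Ioi 0 ×ˢ Ω ×ˢ Ω)
  represents : ∀ t : ℝ, 0 < t → ∀ f : L2 Ω, ∀ᵐ x ∂(volume.restrict Ω),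
    IntegrableOn (fun y => k t x y * f y) Ω volume ∧ S t f x = ∫ y in Ω, k t x y * f y

variable {φ ψ : EuclideanSpace ℝ (Fin d) → ℝ}

theorem RepresentsSemigroup.continuousOn_kernelAction (hk : RepresentsSemigroup S k)
    (hφ : Continuous φ) (hs : HasCompactSupport φ) (hsupp : tsupport φ ⊆ Ω) :
    ContinuousOn (fun p : ℝ × EuclideanSpace ℝ (Fin d) => kernelAction k φ p.1 p.2)
      (Ioi 0 ×ˢ Ω) := by
  refine continuousOn_integral_smul hk.isOpen hs.isCompact hsupp
    (g := fun _ : ℝ × EuclideanSpace ℝ (Fin d) => φ)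
    (u := fun p : ℝ × EuclideanSpace ℝ (Fin d) => k p.1 p.2) (by fun_prop) ?_
    fun p _ y hy => image_eq_zero_of_notMem_tsupport hy
  exact hk.continuousOn.comp (f := fun p : (ℝ × EuclideanSpace ℝ (Fin d)) ×
    EuclideanSpace ℝ (Fin d) => (p.1.1, p.1.2, p.2)) (by fun_prop)
    fun p hp => ⟨hp.1.1, hp.1.2, hp.2⟩

theorem RepresentsSemigroup.apply_testLp (hk : RepresentsSemigroup S k)
    (hφ : Continuous φ) (hs : HasCompactSupport φ) (hsupp : tsupport φ ⊆ Ω) {s : ℝ}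
    (hs0 : 0 < s) :
    S s (testLp Ω φ hφ hs) =ᵐ[volume.restrict Ω] kernelAction k φ s := by
  filter_upwards [hk.represents s hs0 (testLp Ω φ hφ hs)] with y hy
  have h0 : ∫ z in Ω, φ z • k s y z = kernelAction k φ s y :=
    setIntegral_eq_integral_of_forall_compl_eq_zero fun z hz => by
      rw [image_eq_zero_of_notMem_tsupport fun h => hz (hsupp h), zero_smul]
  rw [hy.2, ← h0]
  refine integral_congr_ae ?_
  filter_upwards [coeFn_testLp Ω φ hφ hs] with z hz
  rw [hz]
  simp [mul_comm]

theorem RepresentsSemigroup.inner_testLp (hk : RepresentsSemigroup S k)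
    (hφ : Continuous φ) (hs : HasCompactSupport φ) (hsupp : tsupport φ ⊆ Ω)
    (hψ : Continuous ψ) (hs' : HasCompactSupport ψ) (hsupp' : tsupport ψ ⊆ Ω) {s : ℝ}
    (hs0 : 0 < s) :
    inner ℂ (testLp Ω ψ hψ hs') (S s (testLp Ω φ hφ hs)) = ∫ y, ψ y • kernelAction k φ s y :=
  inner_testLp_eq hψ hs' hsupp' (hk.apply_testLp hφ hs hsupp hs0)

/-- `e^{-sH}φ` is a weak solution of the heat equation for every test function `φ`. -/
theorem RepresentsSemigroup.isWeakHeatSolution_kernelAction (hk : RepresentsSemigroup S k)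
    (hH : IsNonnegSelfAdjointExtension Ω H) (hS : IsSemigroupGeneratedByNeg H S)
    (hφ : ContDiff ℝ ∞ φ) (hs : HasCompactSupport φ) (hsupp : tsupport φ ⊆ Ω) :
    IsWeakHeatSolution Ω (kernelAction k φ) := by
  refine ⟨hk.continuousOn_kernelAction hφ.continuous hs hsupp, ?_⟩
  intro ψ hψ hs' hsupp' a b ha hab
  have hφg := mem_graph_testLp hH hφ hs hsupp
  have hψg := mem_graph_testLp hH hψ hs' hsupp'
  have hmain := hS.inner_sub_eq_integral (testLp Ω ψ hψ.continuous hs') hφg ha.le hab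
  rw [hk.inner_testLp hφ.continuous hs hsupp hψ.continuous hs' hsupp' (ha.trans_le hab),
    hk.inner_testLp hφ.continuous hs hsupp hψ.continuous hs' hsupp' ha] at hmain
  rw [hmain]
  refine intervalIntegral.integral_congr fun s hs1 => ?_
  rw [uIcc_of_le hab] at hs1
  have hs0 : 0 < s := ha.trans_le hs1.1
  -- Symmetry moves `H` from e^{-sH}φ onto `ψ`, where it is -Δ.
  have hsym := inner_graph_symm hH.selfAdjoint hψg (hS.mem_graph hφg hs0.le)
  rw [← hk.inner_testLp hφ.continuous hs hsupp (continuous_laplacian hψ)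
    (hasCompactSupport_laplacian hs') ((tsupport_laplacian_subset ψ).trans hsupp') hs0, map_neg,
    inner_neg_right, ← hsym, inner_neg_left, neg_neg]

/-- Since e^{-sH} commutes with H, the Laplacian lands on `φ`, in the variable of integration. This
makes the identity the weak heat equation for k(s,x,·) at a fixed `x`. It is first obtained after
pairing with every test function in `x`, and continuity in `x` makes it hold at each point. -/
theorem RepresentsSemigroup.kernelAction_sub (hk : RepresentsSemigroup S k)
    (hH : IsNonnegSelfAdjointExtension Ω H) (hS : IsSemigroupGeneratedByNeg H S)
    (hφ : ContDiff ℝ ∞ φ) (hs : HasCompactSupport φ) (hsupp : tsupport φ ⊆ Ω)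
    {x : EuclideanSpace ℝ (Fin d)} (hx : x ∈ Ω) {a b : ℝ} (ha : 0 < a) (hab : a ≤ b) :
    kernelAction k φ b x - kernelAction k φ a x = ∫ s in a..b, kernelAction k (Δ φ) s x := by
  have hΔc := continuous_laplacian hφ
  have hΔs := hasCompactSupport_laplacian hs
  have hΔsupp := (tsupport_laplacian_subset φ).trans hsupp
  have hc := hk.continuousOn_kernelAction hφ.continuous hs hsupp
  have hcΔ := hk.continuousOn_kernelAction hΔc hΔs hΔsupp
  have hslice : ∀ s, 0 < s → ContinuousOn (kernelAction k φ s) Ω := fun s hs =>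
    hc.comp (f := fun y => (s, y)) (by fun_prop) fun y hy => ⟨hs, hy⟩
  have hb : 0 < b := ha.trans_le hab
  have hint : ContinuousOn (fun y => ∫ s in a..b, kernelAction k (Δ φ) s y) Ω := by
    rw [continuousOn_iff_continuous_domRestrict]
    -- Replacing s by max a s makes the integrand continuous for all real s without changing it on
    -- [a, b].
    have h1 : Continuous (Function.uncurry fun (y : Ω) (s : ℝ) =>
        kernelAction k (Δ φ) (max a s) y) :=
      hcΔ.comp_continuous (f := fun p : Ω × ℝ => (max a p.2, (p.1 : EuclideanSpace ℝ (Fin d))))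
        (by fun_prop) fun p => ⟨ha.trans_le (le_max_left _ _), p.1.2⟩
    refine (intervalIntegral.continuous_parametric_intervalIntegral_of_continuous'
      (μ := volume) h1 a b).congr fun y => ?_
    refine intervalIntegral.integral_congr fun s hs1 => ?_
    rw [uIcc_of_le hab] at hs1
    simp only [max_eq_right hs1.1]
  have hcont : ContinuousOn (fun y => kernelAction k φ b y - kernelAction k φ a y -
      ∫ s in a..b, kernelAction k (Δ φ) s y) Ω := ((hslice b hb).sub (hslice a ha)).sub hint
  -- The fundamental lemma of the calculus of variations gives the identity almost everywhere;
  -- continuity then gives it at `x`.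
  have hae := hk.isOpen.ae_eq_zero_of_integral_contDiff_smul_eq_zero
    (μ := (volume : Measure (EuclideanSpace ℝ (Fin d))))
    (hcont.locallyIntegrableOn hk.isOpen.measurableSet) ?_
  · have heq := Measure.eqOn_open_of_ae_eq (μ := (volume : Measure (EuclideanSpace ℝ (Fin d))))
      (g := fun _ => (0 : ℂ)) ((ae_restrict_iff' hk.isOpen.measurableSet).2 hae)
      hk.isOpen hcont continuousOn_const hx
    exact sub_eq_zero.1 heq
  · intro ψ hψ hs' hsupp'
    have hψc := hψ.continuous
    have hK := hs'.isCompact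
    have hz : ∀ y ∉ tsupport ψ, ψ y = 0 := fun y hy => image_eq_zero_of_notMem_tsupport hy
    have hi : ∀ w : EuclideanSpace ℝ (Fin d) → ℂ, ContinuousOn w Ω →
        Integrable fun y => ψ y • w y := by
      intro w hw
      have h1 := continuousOn_smul_of_eq_zero (S := (univ : Set Unit)) hk.isOpen hK.isClosed hsupp'
        (g := fun _ => ψ) (u := fun _ => w) (by fun_prop)
        (hw.comp (f := fun p : Unit × EuclideanSpace ℝ (Fin d) => p.2) (by fun_prop)
          fun p hp => hp.2) fun _ _ y hy => hz y hy
      exact integrable_slice (W := fun _ y => ψ y • w y) (p := ()) hK h1 trivial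
        fun y hy => by rw [hz y hy, zero_smul]
    have hmain := hS.inner_sub_eq_integral (testLp Ω ψ hψ.continuous hs')
      (mem_graph_testLp hH hφ hs hsupp) ha.le hab
    rw [hk.inner_testLp hφ.continuous hs hsupp hψ.continuous hs' hsupp' hb,
      hk.inner_testLp hφ.continuous hs hsupp hψ.continuous hs' hsupp' ha, neg_neg] at hmain
    -- Fubini applies because the integrand is continuous on the compact set [a, b] × supp ψ and
    -- zero elsewhere.
    have hswap : (∫ s in a..b, ∫ y, ψ y • kernelAction k (Δ φ) s y) =
        ∫ y, ∫ s in a..b, ψ y • kernelAction k (Δ φ) s y := by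
      refine intervalIntegral_integral_swap ?_
      have hc2 := continuousOn_smul_of_eq_zero (S := Ioi (0 : ℝ)) hk.isOpen hK.isClosed hsupp'
        (g := fun _ => ψ) (by fun_prop) hcΔ fun _ _ y hy => hz y hy
      rw [uIoc_of_le hab]
      have h2 : IntegrableOn (fun p : ℝ × EuclideanSpace ℝ (Fin d) =>
          ψ p.2 • kernelAction k (Δ φ) p.1 p.2) (Icc a b ×ˢ tsupport ψ)
          (volume.prod volume) :=
        (hc2.mono (prod_mono (fun r hr => ha.trans_le hr.1) (subset_univ _))).integrableOn_compact
          (isCompact_Icc.prod hK)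
      have h3 : IntegrableOn (fun p : ℝ × EuclideanSpace ℝ (Fin d) =>
          ψ p.2 • kernelAction k (Δ φ) p.1 p.2) (Icc a b ×ˢ univ) (volume.prod volume) := by
        refine h2.of_forall_sdiff_eq_zero (measurableSet_Icc.prod MeasurableSet.univ) ?_
        rintro ⟨s, y⟩ ⟨h, h'⟩
        have : y ∉ tsupport ψ := fun hy => h' ⟨h.1, hy⟩
        simp only [hz y this, zero_smul]
      have h4 := h3.mono_set (prod_mono_left (t := univ) (Ioc_subset_Icc_self (a := a) (b := b)))
      rw [IntegrableOn, ← Measure.prod_restrict, Measure.restrict_univ] at h4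
      exact h4
    have hrhs : (∫ s in a..b, inner ℂ (testLp Ω ψ hψ.continuous hs')
        (S s (testLp Ω (Δ φ) hΔc hΔs))) = ∫ s in a..b, ∫ y, ψ y • kernelAction k (Δ φ) s y := by
      refine intervalIntegral.integral_congr fun s hs1 => ?_
      rw [uIcc_of_le hab] at hs1
      exact hk.inner_testLp hΔc hΔs hΔsupp hψ.continuous hs' hsupp' (ha.trans_le hs1.1)
    rw [hrhs, hswap] at hmain
    have hi2 : Integrable fun y => ψ y • kernelAction k φ b y - ψ y • kernelAction k φ a y :=
      (hi _ (hslice b hb)).sub (hi _ (hslice a ha))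
    simp only [smul_sub]
    rw [integral_sub hi2 (hi _ hint),
      integral_sub (hi _ (hslice b hb)) (hi _ (hslice a ha)), hmain, sub_eq_zero]
    refine integral_congr_ae (Eventually.of_forall fun y => ?_)
    exact intervalIntegral.integral_smul _ _

/-- For fixed `x`, the heat kernel `k(s,x,y)` is a weak solution of the heat equation. -/
theorem RepresentsSemigroup.isWeakHeatSolution_kernel (hk : RepresentsSemigroup S k)
    (hH : IsNonnegSelfAdjointExtension Ω H) (hS : IsSemigroupGeneratedByNeg H S)
    {x : EuclideanSpace ℝ (Fin d)} (hx : x ∈ Ω) :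
    IsWeakHeatSolution Ω fun s y => k s x y := by
  refine ⟨?_, fun ψ hψ hs hsupp a b ha hab => hk.kernelAction_sub hH hS hψ hs hsupp hx ha hab⟩
  exact hk.continuousOn.comp (f := fun p : ℝ × EuclideanSpace ℝ (Fin d) => (p.1, x, p.2))
    (by fun_prop) fun p hp => ⟨hp.1, hx, hp.2⟩

end HeatKernel

/-! ### Scalar inequalities and the time integral. -/

section ScalarEstimates

theorem exists_bound_rpow_mul_exp (p : ℝ) {c : ℝ} (hc : 0 < c) :
    ∃ K : ℝ, 0 < K ∧ ∀ z : ℝ, 0 ≤ z → (1 + z) ^ p * Real.exp (-(c * z)) ≤ K := by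
  obtain ⟨n, hn⟩ := exists_nat_ge p
  refine ⟨n.factorial / c ^ n * Real.exp c, by positivity, fun z hz => ?_⟩
  have h1 : (1 + z) ^ p ≤ (1 + z) ^ n := by
    rw [← Real.rpow_natCast]
    exact Real.rpow_le_rpow_of_exponent_le (by linarith) hn
  have h2 := Real.pow_div_factorial_le_exp (c * (1 + z)) (by positivity) n
  have h3 : (1 + z) ^ n ≤ n.factorial / c ^ n * Real.exp (c * (1 + z)) := by
    rw [mul_pow, div_le_iff₀ (by positivity)] at h2
    rw [div_mul_eq_mul_div, le_div_iff₀ (by positivity)]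
    linarith
  calc (1 + z) ^ p * Real.exp (-(c * z))
      ≤ n.factorial / c ^ n * Real.exp (c * (1 + z)) * Real.exp (-(c * z)) := by
        gcongr
        exact h1.trans h3
    _ = n.factorial / c ^ n * Real.exp c := by
        rw [mul_assoc, ← Real.exp_add]
        ring_nf

/-- An integrable majorant of `R^{d-2} s^{-d/2} e^{-cR²/s}` up to a constant. -/
noncomputable def heatMajorant (d : ℕ) (R s : ℝ) : ℝ :=
  (R ^ 2)⁻¹ * (1 + s / R ^ 2) ^ (-(if d = 2 then (1 : ℝ) else 3 / 2))

theorem heatMajorant_nonneg (d : ℕ) (R : ℝ) {s : ℝ} (hs : 0 ≤ s) : 0 ≤ heatMajorant d R s := by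
  unfold heatMajorant; positivity

theorem continuousOn_heatMajorant (d : ℕ) (R : ℝ) :
    ContinuousOn (heatMajorant d R) (Ici 0) := by
  unfold heatMajorant
  refine continuousOn_const.mul (ContinuousOn.rpow_const (by fun_prop) fun s hs => Or.inl ?_)
  have : 0 ≤ s / R ^ 2 := div_nonneg hs (by positivity)
  linarith

/-- With z = R²/s, the exponential controls large z (small times), while for small z only the power
z^{d/2} matters. It is weakened to z^m with m = 1 for d = 2 and m = 3/2 for d ≥ 3: any m in (1, d/2]
makes the time integral converge, and d = 2 leaves no such m. -/
theorem exists_bound_heatMajorant {d : ℕ} (hd : 2 ≤ d) {c : ℝ} (hc : 0 < c) :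
    ∃ K : ℝ, 0 < K ∧ ∀ R s : ℝ, 0 < R → 0 < s →
      (R ^ 2)⁻¹ * ((R ^ 2 / s) ^ ((d : ℝ) / 2) * Real.exp (-(c * (R ^ 2 / s)))) ≤
        K * heatMajorant d R s := by
  obtain ⟨K, hK, hb⟩ := exists_bound_rpow_mul_exp ((d : ℝ) / 2) hc
  refine ⟨K, hK, fun R s hR hs => ?_⟩
  set m : ℝ := if d = 2 then (1 : ℝ) else 3 / 2 with hm
  have hm0 : 0 ≤ m := by rw [hm]; split_ifs <;> norm_num
  have hmp : m ≤ (d : ℝ) / 2 := by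
    rw [hm]
    split_ifs with h
    · subst h; norm_num
    · have h3 : (3 : ℝ) ≤ d := by exact_mod_cast (by omega : 3 ≤ d)
      linarith
  have hz : 0 < R ^ 2 / s := by positivity
  set z := R ^ 2 / s with hzd
  have e1 : 1 + s / R ^ 2 = (1 + z) / z := by
    rw [hzd]; field_simp; ring
  have e2 : (1 + s / R ^ 2) ^ (-m) = z ^ m / (1 + z) ^ m := by
    rw [e1, Real.rpow_neg (by positivity), Real.div_rpow (by positivity) hz.le, inv_div]
  rw [heatMajorant, ← hm, e2, mul_left_comm K]
  refine mul_le_mul_of_nonneg_left ?_ (by positivity)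
  rw [← mul_div_assoc K, le_div_iff₀ (by positivity)]
  calc z ^ ((d : ℝ) / 2) * Real.exp (-(c * z)) * (1 + z) ^ m
      = z ^ m * (z ^ ((d : ℝ) / 2 - m) * (1 + z) ^ m * Real.exp (-(c * z))) := by
        conv_lhs => rw [show (d : ℝ) / 2 = m + ((d : ℝ) / 2 - m) by ring, Real.rpow_add hz]
        ring
    _ ≤ z ^ m * ((1 + z) ^ ((d : ℝ) / 2 - m) * (1 + z) ^ m * Real.exp (-(c * z))) := by
        gcongr
        linarith
    _ = z ^ m * ((1 + z) ^ ((d : ℝ) / 2) * Real.exp (-(c * z))) := by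
        rw [← Real.rpow_add (by positivity), sub_add_cancel]
    _ ≤ z ^ m * K := by gcongr; exact hb z hz.le
    _ = K * z ^ m := mul_comm _ _

theorem log_one_add_sq_le {w : ℝ} (hw : 0 < w) : Real.log (1 + w ^ 2) ≤ 2 * (1 + Real.posLog w) := by
  have h2 : Real.log 2 ≤ 1 := by
    have := Real.log_two_lt_d9
    linarith
  rcases le_total w 1 with h | h
  · have h1 : Real.log (1 + w ^ 2) ≤ Real.log 2 :=
      Real.log_le_log (by positivity) (by nlinarith)
    have := Real.posLog_nonneg (x := w)
    linarith
  · have h1 : Real.log (1 + w ^ 2) ≤ Real.log (2 * w ^ 2) :=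
      Real.log_le_log (by positivity) (by nlinarith)
    rw [Real.log_mul (by norm_num) (by positivity), Real.log_pow] at h1
    have h3 : Real.log w ≤ Real.posLog w := le_max_right _ _
    push_cast at h1
    linarith

/-- The origin of κ_d: the primitive is log(1 + s/R²) when d = 2, and the bounded function -2(1 +
s/R²)^{-1/2} otherwise. -/
theorem integral_heatMajorant_le (d : ℕ) {R t : ℝ} (hR : 0 < R) (ht : 0 < t) :
    ∫ s in (0 : ℝ)..t, heatMajorant d R s ≤
      2 * (1 + Real.posLog (Real.sqrt t / R)) ^ kappa d := by
  have hsub : uIcc 0 t ⊆ Ici 0 := by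
    rw [uIcc_of_le ht.le]; exact Icc_subset_Ici_self
  have hint : IntervalIntegrable (heatMajorant d R) volume 0 t :=
    ((continuousOn_heatMajorant d R).mono hsub).intervalIntegrable
  have hlin : ∀ s : ℝ, HasDerivAt (fun s : ℝ => 1 + s / R ^ 2) (R ^ 2)⁻¹ s := fun s => by
    simpa [one_div] using ((hasDerivAt_id s).div_const (R ^ 2)).const_add 1
  have hpos : ∀ s ∈ uIcc 0 t, 0 < 1 + s / R ^ 2 := fun s hs => by
    have : 0 ≤ s / R ^ 2 := div_nonneg (hsub hs) (by positivity)
    linarith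
  by_cases hd : d = 2
  · have hder : ∀ s ∈ uIcc 0 t, HasDerivAt (fun s => Real.log (1 + s / R ^ 2))
        (heatMajorant d R s) s := fun s hs => by
      refine ((hlin s).log (hpos s hs).ne').congr_deriv ?_
      rw [heatMajorant, if_pos hd, Real.rpow_neg_one, div_eq_mul_inv]
    rw [intervalIntegral.integral_eq_sub_of_hasDerivAt hder hint, kappa, if_pos hd, pow_one]
    have hw : 0 < Real.sqrt t / R := by positivity
    have := log_one_add_sq_le hw
    rw [div_pow, Real.sq_sqrt ht.le] at this
    simpa using this
  · have hder : ∀ s ∈ uIcc 0 t, HasDerivAt (fun s => -2 * (1 + s / R ^ 2) ^ (-(1 / 2) : ℝ))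
        (heatMajorant d R s) s := fun s hs => by
      refine (((hlin s).rpow_const (p := -(1 / 2)) (Or.inl (hpos s hs).ne')).const_mul
        (-2)).congr_deriv ?_
      rw [heatMajorant, if_neg hd, show (-(1 / 2) - 1 : ℝ) = -(3 / 2) by norm_num]
      ring
    rw [intervalIntegral.integral_eq_sub_of_hasDerivAt hder hint, kappa, if_neg hd, pow_zero]
    have : 0 ≤ (1 + t / R ^ 2) ^ (-(1 / 2) : ℝ) := by positivity
    simp only [zero_div, add_zero, Real.one_rpow]
    linarith

/-- The larger of `s` and `σ` is at least t/2, so `t ^ p` cancels its negative power up to `2 ^ p`;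
only the smaller time stays singular. -/
theorem mul_rpow_neg_le {p s σ t R : ℝ} (hp : 0 ≤ p) (hs : 0 < s) (hσ : 0 < σ)
    (ht : s + σ = t) (hR : 0 < R) :
    (R ^ 2) ^ p * (t ^ p * (σ ^ (-p) * s ^ (-p))) ≤
      2 ^ p * ((R ^ 2 / s) ^ p + (R ^ 2 / σ) ^ p) := by
  have ht0 : 0 < t := by linarith
  have hR2 : 0 < R ^ 2 := by positivity
  have key : ∀ a b : ℝ, 0 < a → 0 < b → t ≤ 2 * b →
      (R ^ 2) ^ p * (t ^ p * (b ^ (-p) * a ^ (-p))) ≤ 2 ^ p * (R ^ 2 / a) ^ p := by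
    intro a b ha hb htb
    have h1 : t ^ p ≤ 2 ^ p * b ^ p := by
      rw [← Real.mul_rpow (by norm_num) hb.le]
      exact Real.rpow_le_rpow ht0.le htb hp
    rw [Real.div_rpow hR2.le ha.le, Real.rpow_neg hb.le, Real.rpow_neg ha.le]
    have h2 : 0 < b ^ p := by positivity
    have h3 : t ^ p * (b ^ p)⁻¹ ≤ 2 ^ p := by
      rw [← div_eq_mul_inv, div_le_iff₀ h2]; exact h1
    calc (R ^ 2) ^ p * (t ^ p * ((b ^ p)⁻¹ * (a ^ p)⁻¹))
        = (t ^ p * (b ^ p)⁻¹) * ((R ^ 2) ^ p / a ^ p) := by ring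
      _ ≤ _ := by gcongr
  have hn1 : 0 ≤ 2 ^ p * (R ^ 2 / s) ^ p := by positivity
  have hn2 : 0 ≤ 2 ^ p * (R ^ 2 / σ) ^ p := by positivity
  rcases le_total s σ with h | h
  · have := key s σ hs hσ (by linarith)
    linarith
  · have := key σ s hσ hs (by linarith)
    rw [mul_comm (s ^ (-p))] at this
    linarith

/-- The inequality of harmonic and arithmetic means. Its factor 4 cancels the 4 in the Gaussian
exponents, which is why the final exponent has R²/t and not R²/(4t). -/
theorem four_div_le {s σ t : ℝ} (hs : 0 < s) (hσ : 0 < σ) (ht : s + σ = t) (a : ℝ) (ha : 0 ≤ a) :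
    4 * (a / t) ≤ a / s + a / σ := by
  subst ht
  rw [div_add_div _ _ hs.ne' hσ.ne', mul_div_assoc', div_le_div_iff₀ (by positivity) (by positivity)]
  nlinarith [mul_nonneg ha (sq_nonneg (s - σ))]

/-- The pointwise-in-time bound for the commutator term in Duhamel's formula. -/
theorem exists_duhamel_integrand_bound {d : ℕ} (hd : 2 ≤ d) {δ δ' α : ℝ} (hδ : 0 < δ)
    (hδ' : δ < δ') (hα0 : 0 < α) (hα : 1 / (1 + δ') < α / (1 + δ)) :
    ∃ C : ℝ, 0 < C ∧ ∀ R s σ t : ℝ, 0 < R → 0 < s → 0 < σ → s + σ = t →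
      (R ^ 2) ^ ((d : ℝ) / 2) * t ^ ((d : ℝ) / 2) * (((4 + 2 * d) / R ^ 2 + 2 / σ) *
        (σ ^ (-((d : ℝ) / 2)) * Real.exp (-(α * R ^ 2 / (4 * σ)))) *
        (s ^ (-((d : ℝ) / 2)) * Real.exp (-(α * R ^ 2 / (4 * (1 + δ) * s))))) ≤
      C * Real.exp (-(R ^ 2 / ((1 + δ') * t))) * (heatMajorant d R s + heatMajorant d R σ) := by
  -- The surplus in the exponent is 8c. After the division by 4 in the Gaussians, a factor
  -- exp(-2cR²/τ) is to spare at each of the times τ = s and τ = σ. Two copies of exp(-cR²/σ) and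
  -- one of exp(-cR²/s) are kept.
  set c : ℝ := (α / (1 + δ) - 1 / (1 + δ')) / 8 with hc
  have hc0 : 0 < c := by rw [hc]; linarith
  obtain ⟨K₁, hK₁, hb₁⟩ := exists_bound_rpow_mul_exp 1 hc0
  obtain ⟨K₂, hK₂, hb₂⟩ := exists_bound_heatMajorant hd hc0
  refine ⟨(4 + 2 * d) * 2 ^ ((d : ℝ) / 2) * K₁ * K₂, by positivity, ?_⟩
  intro R s σ t hR hs hσ ht
  have ht0 : 0 < t := by linarith
  set p : ℝ := (d : ℝ) / 2 with hp
  have hp0 : 0 ≤ p := by positivity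
  have hzs : 0 < R ^ 2 / s := by positivity
  have hzσ : 0 < R ^ 2 / σ := by positivity
  have hexp : Real.exp (-(α * R ^ 2 / (4 * σ))) * Real.exp (-(α * R ^ 2 / (4 * (1 + δ) * s))) ≤
      Real.exp (-(R ^ 2 / ((1 + δ') * t))) * (Real.exp (-(c * (R ^ 2 / s))) *
        (Real.exp (-(c * (R ^ 2 / σ))) * Real.exp (-(c * (R ^ 2 / σ))))) := by
    rw [← Real.exp_add, ← Real.exp_add, ← Real.exp_add, ← Real.exp_add, Real.exp_le_exp]
    have h4 := four_div_le hs hσ ht (R ^ 2) (by positivity)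
    have e1 : α * R ^ 2 / (4 * (1 + δ) * s) = α / (1 + δ) * (R ^ 2 / s) / 4 := by
      have : 1 + δ ≠ 0 := by linarith
      field_simp
    have e2 : α * R ^ 2 / (4 * σ) = α * (R ^ 2 / σ) / 4 := by field_simp
    have e3 : R ^ 2 / ((1 + δ') * t) = 1 / (1 + δ') * (R ^ 2 / t) := by
      have : 1 + δ' ≠ 0 := by linarith
      field_simp
    have h5 : α / (1 + δ) ≤ α := div_le_self hα0.le (by linarith)
    have h6 : α / (1 + δ) = 1 / (1 + δ') + 8 * c := by rw [hc]; ring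
    have h7 : 0 < 1 / (1 + δ') := by
      have : 0 < 1 + δ' := by linarith
      positivity
    rw [e1, e2, e3]
    have h8 := mul_le_mul_of_nonneg_right h5 hzσ.le
    rw [h6] at h8 ⊢
    have h9 := mul_le_mul_of_nonneg_left h4 h7.le
    have h10 := mul_pos hc0 hzs
    nlinarith
  have hcoef : (4 + 2 * d) / R ^ 2 + 2 / σ ≤
      (4 + 2 * d) * ((R ^ 2)⁻¹ * (1 + R ^ 2 / σ)) := by
    have e : (R ^ 2)⁻¹ * (1 + R ^ 2 / σ) = 1 / R ^ 2 + 1 / σ := by field_simp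
    rw [e]
    have h1 : (0 : ℝ) ≤ (2 + 2 * d) * (1 / σ) := by positivity
    have e2 : (4 + 2 * (d : ℝ)) / R ^ 2 = (4 + 2 * d) * (1 / R ^ 2) := by ring
    have e3 : 2 / σ = 2 * (1 / σ) := by ring
    rw [e2, e3]
    nlinarith
  have hz1 : (1 + R ^ 2 / σ) * Real.exp (-(c * (R ^ 2 / σ))) ≤ K₁ := by
    simpa using hb₁ _ hzσ.le
  have hes : Real.exp (-(c * (R ^ 2 / s))) ≤ 1 := Real.exp_le_one_iff.2 (by
    have := mul_pos hc0 hzs; linarith)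
  have heσ : Real.exp (-(c * (R ^ 2 / σ))) ≤ 1 := Real.exp_le_one_iff.2 (by
    have := mul_pos hc0 hzσ; linarith)
  have hQs := hb₂ R s hR hs
  have hQσ := hb₂ R σ hR hσ
  have hpow := mul_rpow_neg_le hp0 hs hσ ht hR
  set es := Real.exp (-(c * (R ^ 2 / s))) with hes'
  set eσ := Real.exp (-(c * (R ^ 2 / σ))) with heσ'
  set E := Real.exp (-(R ^ 2 / ((1 + δ') * t)))
  have hes0 : 0 < es := Real.exp_pos _
  have heσ0 : 0 < eσ := Real.exp_pos _
  have hE0 : 0 < E := Real.exp_pos _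
  have hzp1 : 0 ≤ (R ^ 2 / s) ^ p := by positivity
  have hzp2 : 0 ≤ (R ^ 2 / σ) ^ p := by positivity
  calc (R ^ 2) ^ p * t ^ p * (((4 + 2 * d) / R ^ 2 + 2 / σ) *
        (σ ^ (-p) * Real.exp (-(α * R ^ 2 / (4 * σ)))) *
        (s ^ (-p) * Real.exp (-(α * R ^ 2 / (4 * (1 + δ) * s)))))
      = ((R ^ 2) ^ p * (t ^ p * (σ ^ (-p) * s ^ (-p)))) * ((4 + 2 * d) / R ^ 2 + 2 / σ) *
        (Real.exp (-(α * R ^ 2 / (4 * σ))) * Real.exp (-(α * R ^ 2 / (4 * (1 + δ) * s)))) := by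
        ring
    _ ≤ (2 ^ p * ((R ^ 2 / s) ^ p + (R ^ 2 / σ) ^ p)) *
        ((4 + 2 * d) * ((R ^ 2)⁻¹ * (1 + R ^ 2 / σ))) * (E * (es * (eσ * eσ))) := by
        gcongr
    _ = (4 + 2 * d) * 2 ^ p * E * ((1 + R ^ 2 / σ) * eσ) *
        ((R ^ 2)⁻¹ * (((R ^ 2 / s) ^ p * es) * eσ + ((R ^ 2 / σ) ^ p * eσ) * es)) := by
        ring
    -- One `eσ` absorbs the factor 1 + R²/σ coming from the commutator. In each summand the decay at
    -- the time of the singular power is retained for `heatMajorant`, and the other factor is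
    -- bounded by 1.
    _ ≤ (4 + 2 * d) * 2 ^ p * E * K₁ *
        ((R ^ 2)⁻¹ * (((R ^ 2 / s) ^ p * es) * 1 + ((R ^ 2 / σ) ^ p * eσ) * 1)) := by
        gcongr
    _ = (4 + 2 * d) * 2 ^ p * E * K₁ *
        ((R ^ 2)⁻¹ * ((R ^ 2 / s) ^ p * es) + (R ^ 2)⁻¹ * ((R ^ 2 / σ) ^ p * eσ)) := by ring
    _ ≤ (4 + 2 * d) * 2 ^ p * E * K₁ *
        (K₂ * heatMajorant d R s + K₂ * heatMajorant d R σ) := by gcongr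
    _ = _ := by ring

end ScalarEstimates

/-! ### The cutoff and the size of its commutator. -/

section Cutoff

variable {d : ℕ}

theorem exists_cutoff {α β : ℝ} (hαβ : α < β) :
    ∃ h : ℝ → ℝ, ContDiff ℝ ∞ h ∧ (∀ r, r ≤ α → h r = 1) ∧ (∀ r, β ≤ r → h r = 0) ∧
      (∀ r, r ∉ Icc α β → deriv h r = 0 ∧ deriv (deriv h) r = 0) ∧
      ∃ A : ℝ, 0 < A ∧ ∀ r, |deriv h r| ≤ A ∧ |deriv (deriv h) r| ≤ A := by
  set h : ℝ → ℝ := fun r => Real.smoothTransition ((β - r) / (β - α)) with hh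
  have hpos : 0 < β - α := sub_pos.2 hαβ
  have hsm : ContDiff ℝ ∞ h := Real.smoothTransition.contDiff.comp (by fun_prop)
  have h1 : ∀ r, r ≤ α → h r = 1 := fun r hr =>
    Real.smoothTransition.one_of_one_le ((one_le_div hpos).2 (by linarith))
  have h0 : ∀ r, β ≤ r → h r = 0 := fun r hr =>
    Real.smoothTransition.zero_of_nonpos (div_nonpos_of_nonpos_of_nonneg (by linarith) hpos.le)
  have hd1 := contDiff_deriv hsm
  have hd2 := contDiff_deriv hd1
  obtain ⟨A₁, hA₁⟩ := (isCompact_Icc (a := α) (b := β)).exists_bound_of_continuousOn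
    hd1.continuous.continuousOn
  obtain ⟨A₂, hA₂⟩ := (isCompact_Icc (a := α) (b := β)).exists_bound_of_continuousOn
    hd2.continuous.continuousOn
  have hz1 : ∀ r, r ∉ Icc α β → deriv h r = 0 := by
    intro r hr
    rw [mem_Icc, not_and_or, not_le, not_le] at hr
    rcases hr with hr | hr
    · have : h =ᶠ[𝓝 r] fun _ => 1 := by
        filter_upwards [gt_mem_nhds hr] with s hs using h1 s hs.le
      rw [this.deriv_eq]; simp
    · have : h =ᶠ[𝓝 r] fun _ => 0 := by
        filter_upwards [lt_mem_nhds hr] with s hs using h0 s hs.le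
      rw [this.deriv_eq]; simp
  have hz2 : ∀ r, r ∉ Icc α β → deriv (deriv h) r = 0 := by
    intro r hr
    have : deriv h =ᶠ[𝓝 r] fun _ => 0 := by
      filter_upwards [isClosed_Icc.isOpen_compl.mem_nhds hr] with s hs using hz1 s hs
    rw [this.deriv_eq]; simp
  refine ⟨h, hsm, h1, h0, fun r hr => ⟨hz1 r hr, hz2 r hr⟩, max (max A₁ A₂) 1, lt_max_of_lt_right one_pos, fun r => ?_⟩
  by_cases hr : r ∈ Icc α β
  · exact ⟨(hA₁ r hr).trans ((le_max_left _ _).trans (le_max_left _ _)),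
      (hA₂ r hr).trans ((le_max_right _ _).trans (le_max_left _ _))⟩
  · rw [hz1 r hr, hz2 r hr, abs_zero]
    exact ⟨le_max_of_le_right zero_le_one, le_max_of_le_right zero_le_one⟩

/-- Bound of the commutator for the cutoff `h(|y-x|²/R²)`, which is supported in the annulus
`αR² ≤ |y-x|² ≤ βR²`. -/
theorem abs_cutGaussCommutator_le {h : ℝ → ℝ} (hsm : ContDiff ℝ ∞ h) {α β A : ℝ}
    (hβ : β ≤ 1)
    (hz : ∀ r, r ∉ Icc α β → deriv h r = 0 ∧ deriv (deriv h) r = 0) (hA : 0 < A)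
    (hbd : ∀ r, |deriv h r| ≤ A ∧ |deriv (deriv h) r| ≤ A) {R : ℝ} (hR : 0 < R)
    (x : EuclideanSpace ℝ (Fin d)) {σ : ℝ} (hσ : 0 < σ) (y : EuclideanSpace ℝ (Fin d)) :
    (cutGaussCommutator (fun r => h (r / R ^ 2)) x σ y ≠ 0 → α * R ^ 2 ≤ ‖y - x‖ ^ 2) ∧
      |cutGaussCommutator (fun r => h (r / R ^ 2)) x σ y| ≤
        A * ((4 + 2 * d) / R ^ 2 + 2 / σ) *
          ((4 * Real.pi * σ) ^ (-((d : ℝ) / 2)) * Real.exp (-(α * R ^ 2 / (4 * σ)))) := by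
  have hR2 : 0 < R ^ 2 := by positivity
  have e1 : deriv (fun r => h (r / R ^ 2)) = fun r => deriv h (r / R ^ 2) / R ^ 2 := by
    funext r
    have := (contDiff_hasDerivAt hsm (r / R ^ 2)).comp r ((hasDerivAt_id r).div_const (R ^ 2))
    exact this.deriv.trans (by ring)
  have e2 : ∀ r, deriv (deriv (fun r => h (r / R ^ 2))) r =
      deriv (deriv h) (r / R ^ 2) / R ^ 2 / R ^ 2 := by
    intro r
    rw [e1]
    have := (((contDiff_hasDerivAt (contDiff_deriv hsm) (r / R ^ 2)).comp r
      ((hasDerivAt_id r).div_const (R ^ 2))).div_const (R ^ 2))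
    exact this.deriv.trans (by ring)
  by_cases hr : ‖y - x‖ ^ 2 / R ^ 2 ∈ Icc α β
  · have hr1 : α * R ^ 2 ≤ ‖y - x‖ ^ 2 := (le_div_iff₀ hR2).1 hr.1
    refine ⟨fun _ => hr1, ?_⟩
    set r := ‖y - x‖ ^ 2 with hrd
    have hr0 : 0 ≤ r := by positivity
    have hr2 : r ≤ R ^ 2 := by
      have := (div_le_iff₀ hR2).1 (hr.2.trans hβ)
      linarith
    rw [cutGaussCommutator, ← hrd, e2, e1, gaussProfile, abs_mul,
      abs_of_nonneg (by positivity : 0 ≤ (4 * Real.pi * σ) ^ (-((d : ℝ) / 2)) *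
        Real.exp (-(r / (4 * σ))))]
    have hcoef : |4 * r * (deriv (deriv h) (r / R ^ 2) / R ^ 2 / R ^ 2) +
        2 * d * (deriv h (r / R ^ 2) / R ^ 2) - 2 * r / σ * (deriv h (r / R ^ 2) / R ^ 2)| ≤
        A * ((4 + 2 * d) / R ^ 2 + 2 / σ) := by
      obtain ⟨hb1, hb2⟩ := hbd (r / R ^ 2)
      have hq : r / R ^ 2 ≤ 1 := (div_le_one hR2).2 hr2
      have hq0 : 0 ≤ r / R ^ 2 := by positivity
      have t1 : |4 * r * (deriv (deriv h) (r / R ^ 2) / R ^ 2 / R ^ 2)| ≤ 4 / R ^ 2 * A := by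
        rw [show 4 * r * (deriv (deriv h) (r / R ^ 2) / R ^ 2 / R ^ 2) =
          4 / R ^ 2 * (r / R ^ 2) * deriv (deriv h) (r / R ^ 2) by ring, abs_mul,
          abs_of_nonneg (by positivity : 0 ≤ 4 / R ^ 2 * (r / R ^ 2))]
        calc 4 / R ^ 2 * (r / R ^ 2) * |deriv (deriv h) (r / R ^ 2)|
            ≤ 4 / R ^ 2 * 1 * A := by gcongr
          _ = _ := by ring
      have t2 : |2 * d * (deriv h (r / R ^ 2) / R ^ 2)| ≤ 2 * d / R ^ 2 * A := by
        rw [show 2 * d * (deriv h (r / R ^ 2) / R ^ 2) =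
          2 * d / R ^ 2 * deriv h (r / R ^ 2) by ring, abs_mul,
          abs_of_nonneg (by positivity : 0 ≤ 2 * (d : ℝ) / R ^ 2)]
        gcongr
      have t3 : |2 * r / σ * (deriv h (r / R ^ 2) / R ^ 2)| ≤ 2 / σ * A := by
        rw [show 2 * r / σ * (deriv h (r / R ^ 2) / R ^ 2) =
          2 / σ * (r / R ^ 2) * deriv h (r / R ^ 2) by ring, abs_mul,
          abs_of_nonneg (by positivity : 0 ≤ 2 / σ * (r / R ^ 2))]
        calc 2 / σ * (r / R ^ 2) * |deriv h (r / R ^ 2)| ≤ 2 / σ * 1 * A := by gcongr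
          _ = _ := by ring
      refine (abs_sub _ _).trans ((add_le_add ((abs_add_le _ _).trans (add_le_add t1 t2)) t3).trans
        (le_of_eq ?_))
      ring
    gcongr
  · have hc : cutGaussCommutator (fun r => h (r / R ^ 2)) x σ y = 0 := by
      rw [cutGaussCommutator, e2, e1]
      simp only
      rw [(hz _ hr).1, (hz _ hr).2]
      ring
    refine ⟨fun hne => absurd hc hne, ?_⟩
    rw [hc, abs_zero]
    positivity

end Cutoff

/-! ### Pointwise convergence of the semigroup to the initial value. -/

section InitialValue

variable {d : ℕ}

theorem norm_integral_smul_le {K : Set (EuclideanSpace ℝ (Fin d))} (hK : IsCompact K)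
    {q : EuclideanSpace ℝ (Fin d) → ℝ} {w : EuclideanSpace ℝ (Fin d) → ℂ} {G : ℝ}
    (hq : ∀ y, |q y| ≤ G) (hqz : ∀ y ∉ K, q y = 0) (hw : ContinuousOn w K) :
    ‖∫ y, q y • w y‖ ≤ G * ∫ y in K, ‖w y‖ := by
  rw [← setIntegral_eq_integral_of_forall_compl_eq_zero (s := K) fun y hy => by
    rw [hqz y hy, zero_smul], ← integral_const_mul]
  refine norm_integral_le_of_norm_le ((hw.norm.integrableOn_compact hK).const_mul G)
    (Eventually.of_forall fun y => ?_)
  rw [norm_smul, Real.norm_eq_abs]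
  gcongr
  exact hq y

/-- The commutator of a cutoff that is constant near the centre is bounded, uniformly in time. -/
theorem exists_bound_cutGaussCommutator {h : ℝ → ℝ} (hsm : ContDiff ℝ ∞ h) {α β A : ℝ}
    (hα : 0 < α) (hβ : β ≤ 1) (hz : ∀ r, r ∉ Icc α β → deriv h r = 0 ∧ deriv (deriv h) r = 0)
    (hA : 0 < A) (hbd : ∀ r, |deriv h r| ≤ A ∧ |deriv (deriv h) r| ≤ A) {R : ℝ} (hR : 0 < R)
    (x : EuclideanSpace ℝ (Fin d)) :
    ∃ G : ℝ, ∀ σ, 0 < σ → ∀ y, |cutGaussCommutator (fun r => h (r / R ^ 2)) x σ y| ≤ G := by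
  -- Used with z = 1/σ: the exponent d/2 comes from the Gaussian prefactor and the extra 1 from the
  -- term 2/σ.
  obtain ⟨K, hK, hb⟩ := exists_bound_rpow_mul_exp ((d : ℝ) / 2 + 1)
    (show 0 < α * R ^ 2 / 4 by positivity)
  refine ⟨A * ((4 + 2 * d) / R ^ 2 + 2) * (4 * Real.pi) ^ (-((d : ℝ) / 2)) * K,
    fun σ hσ y => ?_⟩
  refine (abs_cutGaussCommutator_le hsm hβ hz hA hbd hR x hσ y).2.trans ?_
  have hz0 : 0 < σ⁻¹ := inv_pos.2 hσ
  have hb' := hb σ⁻¹ hz0.le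
  rw [Real.rpow_add (by positivity), Real.rpow_one] at hb'
  have e1 : (4 * Real.pi * σ) ^ (-((d : ℝ) / 2)) =
      (4 * Real.pi) ^ (-((d : ℝ) / 2)) * σ⁻¹ ^ ((d : ℝ) / 2) := by
    rw [Real.mul_rpow (by positivity) hσ.le, Real.rpow_neg hσ.le, Real.inv_rpow hσ.le]
  have e2 : α * R ^ 2 / (4 * σ) = α * R ^ 2 / 4 * σ⁻¹ := by field_simp
  have e3 : (4 + 2 * d) / R ^ 2 + 2 / σ ≤ ((4 + 2 * d) / R ^ 2 + 2) * (1 + σ⁻¹) := by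
    have h0 : 0 ≤ (4 + 2 * (d : ℝ)) / R ^ 2 * σ⁻¹ := by positivity
    rw [div_eq_mul_inv 2 σ]
    nlinarith
  rw [e1, e2]
  calc A * ((4 + 2 * d) / R ^ 2 + 2 / σ) * ((4 * Real.pi) ^ (-((d : ℝ) / 2)) *
        σ⁻¹ ^ ((d : ℝ) / 2) * Real.exp (-(α * R ^ 2 / 4 * σ⁻¹)))
      ≤ A * (((4 + 2 * d) / R ^ 2 + 2) * (1 + σ⁻¹)) * ((4 * Real.pi) ^ (-((d : ℝ) / 2)) *
        (1 + σ⁻¹) ^ ((d : ℝ) / 2) * Real.exp (-(α * R ^ 2 / 4 * σ⁻¹))) := by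
        gcongr
        linarith
    _ = A * ((4 + 2 * d) / R ^ 2 + 2) * (4 * Real.pi) ^ (-((d : ℝ) / 2)) *
        ((1 + σ⁻¹) ^ ((d : ℝ) / 2) * (1 + σ⁻¹) * Real.exp (-(α * R ^ 2 / 4 * σ⁻¹))) := by ring
    _ ≤ _ := by gcongr

variable {Ω : Set (EuclideanSpace ℝ (Fin d))}

/-- From r ≤ 1 + r². It supplies the local L¹ bound required by `norm_sub_le` from boundedness of
the semigroup orbit in L². -/
theorem setIntegral_norm_le_of_ae_eq {K : Set (EuclideanSpace ℝ (Fin d))} (hK : IsCompact K)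
    (hKΩ : K ⊆ Ω) (f : L2 Ω) {w : EuclideanSpace ℝ (Fin d) → ℂ} (hw : ContinuousOn w K)
    (hf : f =ᵐ[volume.restrict Ω] w) :
    ∫ y in K, ‖w y‖ ≤ volume.real K + ‖f‖ ^ 2 := by
  have hfin : IsFiniteMeasure (volume.restrict K) :=
    ⟨by rw [Measure.restrict_apply_univ]; exact hK.measure_lt_top⟩
  have hf' : f =ᵐ[volume.restrict K] w := ae_restrict_of_ae_restrict_of_subset hKΩ hf
  have hinner : Integrable (fun y => (inner ℂ (f y) (f y) : ℂ)) (volume.restrict Ω) :=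
    L2.integrable_inner f f
  have hsq : Integrable (fun y => ‖f y‖ ^ 2) (volume.restrict Ω) := by
    refine hinner.re.congr (Eventually.of_forall fun y => ?_)
    simp only [inner_self_eq_norm_sq_to_K]
    norm_cast
  have hnorm : ∫ y in Ω, ‖f y‖ ^ 2 = ‖f‖ ^ 2 := by
    have h1 : (inner ℂ f f : ℂ) = ∫ y in Ω, inner ℂ (f y) (f y) := L2.inner_def f f
    rw [inner_self_eq_norm_sq_to_K] at h1
    simp only [inner_self_eq_norm_sq_to_K] at h1
    have h2 : ∫ y in Ω, ((‖f y‖ : ℂ)) ^ 2 = ((∫ y in Ω, ‖f y‖ ^ 2 : ℝ) : ℂ) := by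
      rw [← integral_complex_ofReal]
      push_cast
      rfl
    have h3 : ((‖f‖ ^ 2 : ℝ) : ℂ) = ((∫ y in Ω, ‖f y‖ ^ 2 : ℝ) : ℂ) := by
      rw [← h2]
      push_cast
      exact h1
    exact (Complex.ofReal_injective h3).symm
  calc ∫ y in K, ‖w y‖ = ∫ y in K, ‖f y‖ := by
        refine integral_congr_ae ?_
        filter_upwards [hf'] with y hy
        rw [hy]
    _ ≤ ∫ y in K, (1 + ‖f y‖ ^ 2) := by
        refine integral_mono_ae ?_ ((integrable_const 1).add
          (hsq.mono_measure (Measure.restrict_mono hKΩ le_rfl))) ?_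
        · refine (hw.norm.integrableOn_compact hK).congr ?_
          filter_upwards [hf'] with y hy
          rw [hy]
        · refine Eventually.of_forall fun y => ?_
          change ‖f y‖ ≤ 1 + ‖f y‖ ^ 2
          nlinarith [sq_nonneg (‖f y‖ - 1), norm_nonneg (f y)]
    _ = volume.real K + ∫ y in K, ‖f y‖ ^ 2 := by
        rw [integral_add (integrable_const 1)
          (hsq.mono_measure (Measure.restrict_mono hKΩ le_rfl))]
        simp
    _ ≤ volume.real K + ∫ y in Ω, ‖f y‖ ^ 2 := by
        refine (add_le_add_iff_left _).2 (setIntegral_mono_set hsq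
          (Eventually.of_forall fun y => sq_nonneg _) (ae_of_all _ hKΩ))
    _ = _ := by rw [hnorm]

variable {H : L2 Ω →ₗ.[ℂ] L2 Ω} {S : ℝ → L2 Ω →L[ℂ] L2 Ω}
  {k : ℝ → EuclideanSpace ℝ (Fin d) → EuclideanSpace ℝ (Fin d) → ℂ}
  {φ : EuclideanSpace ℝ (Fin d) → ℝ}

/-- The functions `e^{-τH}φ` converge pointwise in `Ω` to the test function `φ` as `τ → 0`. -/
theorem RepresentsSemigroup.tendsto_kernelAction (hk : RepresentsSemigroup S k)
    (hH : IsNonnegSelfAdjointExtension Ω H) (hS : IsSemigroupGeneratedByNeg H S)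
    (hφ : ContDiff ℝ ∞ φ) (hs : HasCompactSupport φ) (hsupp : tsupport φ ⊆ Ω)
    {x : EuclideanSpace ℝ (Fin d)} (hx : x ∈ Ω) :
    Tendsto (fun τ => kernelAction k φ τ x) (𝓝[>] 0) (𝓝 (φ x : ℂ)) := by
  obtain ⟨R, hR, hball⟩ := Metric.nhds_basis_closedBall.mem_iff.1 (hk.isOpen.mem_nhds hx)
  obtain ⟨h, hsm, hh1, hh0, hz, A, hA, hbd⟩ := exists_cutoff (show (1 / 2 : ℝ) < 1 by norm_num)
  set η : ℝ → ℝ := fun r => h (r / R ^ 2) with hηd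
  have hR2 : 0 < R ^ 2 := by positivity
  have hη : ContDiff ℝ ∞ η := hsm.comp (by fun_prop)
  have h0 : ∀ r, R ^ 2 ≤ r → η r = 0 := fun r hr => hh0 _ ((one_le_div hR2).2 hr)
  have hη0 : η 0 = 1 := hh1 _ (by norm_num)
  have hu := hk.isWeakHeatSolution_kernelAction hH hS hφ hs hsupp
  have hK := isCompact_closedBall x R
  have hucont : ∀ s, 0 < s → ContinuousOn (kernelAction k φ s) (Metric.closedBall x R) :=
    fun s hs => hu.continuousOn.comp (f := fun y => (s, y)) (by fun_prop)
      fun y hy => ⟨hs, hball hy⟩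
  set f := testLp Ω φ hφ.continuous hs with hf
  obtain ⟨B, hB⟩ := (isCompact_Icc (a := (0 : ℝ)) (b := 1)).exists_bound_of_continuousOn
    ((hS.strongly_continuous f).mono Icc_subset_Ici_self)
  have hM : ∀ s, 0 < s → s ≤ 1 → ∫ y in Metric.closedBall x R, ‖kernelAction k φ s y‖ ≤
      volume.real (Metric.closedBall x R) + B ^ 2 := by
    intro s hs0 hs1
    refine (setIntegral_norm_le_of_ae_eq hK hball (S s f) (hucont s hs0)
      (hk.apply_testLp hφ.continuous hs hsupp hs0)).trans ?_
    gcongr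
    exact hB s ⟨hs0.le, hs1⟩
  set M := volume.real (Metric.closedBall x R) + B ^ 2 with hMd
  obtain ⟨G, hG⟩ := exists_bound_cutGaussCommutator hsm one_half_pos le_rfl hz hA hbd hR x
  have hG0 : 0 ≤ G := (abs_nonneg _).trans (hG 1 one_pos x)
  have hM0 : 0 ≤ M := by positivity
  -- The commutator and the local L¹ norms are bounded uniformly in time, so the Duhamel error is
  -- O(τ) and only the localized free evolution of `φ` remains.
  have hest : ∀ τ, 0 < τ → τ ≤ 1 →
      ‖kernelAction k φ τ x - ∫ y, cutGauss η x τ y • (φ y : ℂ)‖ ≤ τ * (G * M) := by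
    intro τ hτ hτ1
    have hcs := hasCompactSupport_cutGauss hR h0 x τ
    have hsub := (tsupport_cutGauss_subset hR h0 x τ).trans hball
    have hc := (contDiff_cutGauss hη x τ).continuous
    -- Here L² convergence is enough, because the initial value enters only through its pairing with
    -- the fixed test function `cutGauss η x τ`.
    have hL : Tendsto (fun a => ∫ y, cutGauss η x τ y • kernelAction k φ a y) (𝓝[>] 0)
        (𝓝 (∫ y, cutGauss η x τ y • (φ y : ℂ))) := by
      have h1 : Tendsto (fun a => (inner ℂ (testLp Ω (cutGauss η x τ) hc hcs) (S a f) : ℂ))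
          (𝓝[>] 0) (𝓝 (inner ℂ (testLp Ω (cutGauss η x τ) hc hcs) f)) := by
        have h2 := (hS.strongly_continuous f 0 self_mem_Ici).mono Ioi_subset_Ici_self
        have h3 : Tendsto (fun a => S a f) (𝓝[>] 0) (𝓝 f) := by
          have h4 : S 0 f = f := by rw [hS.zero]; rfl
          simpa only [h4] using h2.tendsto
        exact tendsto_const_nhds.inner h3
      rw [inner_testLp_eq hc hcs hsub (coeFn_testLp Ω φ hφ.continuous hs)] at h1
      refine h1.congr' ?_
      filter_upwards [self_mem_nhdsWithin] with a ha
      exact hk.inner_testLp hφ.continuous hs hsupp hc hcs hsub ha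
    have hmain := hu.norm_sub_le hk.isOpen hR hball hη h0 hη0 hτ (M := M)
      (fun s hs0 hsτ => hM s hs0 (hsτ.trans hτ1)) hL (β := fun _ => G * M) continuousOn_const
      (fun _ _ => by positivity) ?_
    · rwa [intervalIntegral.integral_const, sub_zero, smul_eq_mul] at hmain
    · intro s hs1
      refine (norm_integral_smul_le hK (hG _ (sub_pos.2 hs1.2))
        (fun y hy => cutGaussCommutator_eq_zero hR h0 x _ hy) (hucont s hs1.1)).trans ?_
      gcongr
      exact hM s hs1.1 (hs1.2.le.trans hτ1)
  have hfree : Tendsto (fun τ => ∫ y, cutGauss η x τ y • (φ y : ℂ)) (𝓝[>] 0) (𝓝 (φ x : ℂ)) := by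
    have hφc := hφ.continuous
    have := tendsto_integral_cutGauss_smul hk.isOpen hR hball hη h0
      (u := fun _ y => (φ y : ℂ)) (by fun_prop) one_pos (l := 𝓝[>] (0 : ℝ)) (s := fun _ => 1)
      (σ := fun τ => τ) tendsto_const_nhds tendsto_id
    rwa [hη0, one_smul] at this
  have hdiff : Tendsto (fun τ => kernelAction k φ τ x - ∫ y, cutGauss η x τ y • (φ y : ℂ))
      (𝓝[>] 0) (𝓝 0) := by
    refine squeeze_zero_norm' (a := fun τ => τ * (G * M)) ?_ ?_
    · filter_upwards [Ioo_mem_nhdsGT one_pos] with τ hτ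
      exact hest τ hτ.1 hτ.2.le
    · have : Tendsto (fun τ : ℝ => τ * (G * M)) (𝓝 0) (𝓝 (0 * (G * M))) :=
        (by fun_prop : Continuous _).tendsto 0
      rw [zero_mul] at this
      exact this.mono_left nhdsWithin_le_nhds
  simpa using hdiff.add hfree

end InitialValue

/-! ### The on-diagonal estimate and the passage to the weighted norm. -/

section MainEstimate

variable {d : ℕ}

/-- On-diagonal comparison with the free heat kernel under an explicit Gaussian bound. -/
theorem exists_onDiagonal_bound (hd : 2 ≤ d) {δ δ' : ℝ} (hδ : 0 < δ) (hδ' : δ < δ') :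
    ∃ C : ℝ, 0 < C ∧ ∀ (Ω : Set (EuclideanSpace ℝ (Fin d))) (H : L2 Ω →ₗ.[ℂ] L2 Ω)
      (S : ℝ → L2 Ω →L[ℂ] L2 Ω)
      (k : ℝ → EuclideanSpace ℝ (Fin d) → EuclideanSpace ℝ (Fin d) → ℂ),
      RepresentsSemigroup S k → IsNonnegSelfAdjointExtension Ω H →
      IsSemigroupGeneratedByNeg H S → ∀ (x : EuclideanSpace ℝ (Fin d)) (t R N : ℝ), 0 < t →
      0 < R → Metric.ball x R ⊆ Ω → 0 ≤ N →
      (∀ s, 0 < s → s ≤ t → ∀ y ∈ Metric.ball x R,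
        ‖k s x y‖ ≤ N * (s ^ (-((d : ℝ) / 2)) *
          Real.exp (-(‖y - x‖ ^ 2 / (4 * (1 + δ) * s))))) →
      ‖(((4 * Real.pi * t) ^ ((d : ℝ) / 2) : ℝ) : ℂ) * k t x x - 1‖ ≤
        C * (1 + Real.posLog (Real.sqrt t / R)) ^ kappa d *
          Real.exp (-(R ^ 2 / ((1 + δ') * t))) * N := by
  have hδ1 : 0 < 1 + δ := by linarith
  have hδ1' : 0 < 1 + δ' := by linarith
  have hratio : (1 + δ) / (1 + δ') < 1 := (div_lt_one hδ1').2 (by linarith)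
  have hratio0 : 0 < (1 + δ) / (1 + δ') := by positivity
  -- The loss from evaluating the Gaussians at radius √α R instead of R must fit into the gap
  -- between δ and δ', hence α > (1+δ)/(1+δ'). Taking β < 1 keeps the support of the cutoff inside
  -- the open ball where the kernel bound holds.
  obtain ⟨α, hα1, hα2⟩ := exists_between hratio
  obtain ⟨β, hβ1, hβ2⟩ := exists_between hα2
  have hα0 : 0 < α := hratio0.trans hα1
  have hβ0 : 0 < β := hα0.trans hβ1
  have hα3 : 1 / (1 + δ') < α / (1 + δ) := by
    rw [lt_div_iff₀ hδ1]
    calc 1 / (1 + δ') * (1 + δ) = (1 + δ) / (1 + δ') := by ring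
      _ < α := hα1
  obtain ⟨h, hsm, hh1, hh0, hz, A, hA, hbd⟩ := exists_cutoff hβ1
  obtain ⟨C, hC, hint⟩ := exists_duhamel_integrand_bound hd hδ hδ' hα0 hα3
  set v := volume.real (Metric.ball (0 : EuclideanSpace ℝ (Fin d)) 1) with hv
  have hv0 : 0 ≤ v := measureReal_nonneg
  refine ⟨4 * (A * (v + 1) * C), by positivity, ?_⟩
  intro Ω H S k hk hH hS x t R N ht hR hballR hN hkb
  set p : ℝ := (d : ℝ) / 2 with hp
  have hR2 : 0 < R ^ 2 := by positivity
  set ρ := Real.sqrt β * R with hρd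
  have hρ : 0 < ρ := by positivity
  have hρ2 : ρ ^ 2 = β * R ^ 2 := by rw [hρd, mul_pow, Real.sq_sqrt hβ0.le]
  have hρR : ρ < R := by
    refine lt_of_pow_lt_pow_left₀ 2 hR.le ?_
    rw [hρ2]
    nlinarith
  have hsubR : Metric.closedBall x ρ ⊆ Metric.ball x R := Metric.closedBall_subset_ball hρR
  have hball : Metric.closedBall x ρ ⊆ Ω := hsubR.trans hballR
  have hx : x ∈ Ω := hballR (Metric.mem_ball_self hR)
  set η : ℝ → ℝ := fun r => h (r / R ^ 2) with hηd
  have hη : ContDiff ℝ ∞ η := hsm.comp (by fun_prop)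
  have h0 : ∀ r, ρ ^ 2 ≤ r → η r = 0 := fun r hr => hh0 _ ((le_div_iff₀ hR2).2 (hρ2 ▸ hr))
  have hη0 : η 0 = 1 := hh1 _ (by rw [zero_div]; exact hα0.le)
  have hK := isCompact_closedBall x ρ
  have hu := hk.isWeakHeatSolution_kernel hH hS hx
  have hucont : ∀ s, 0 < s → ContinuousOn (k s x) (Metric.closedBall x ρ) :=
    fun s hs => hu.continuousOn.comp (f := fun y => (s, y)) (by fun_prop)
      fun y hy => ⟨hs, hball hy⟩
  -- The assumed bound is a multiple, independent of s, of the free kernel at time (1+δ)s, whose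
  -- mass is 1.
  have hM : ∀ s, 0 < s → s ≤ t → ∫ y in Metric.closedBall x ρ, ‖k s x y‖ ≤
      N * (4 * Real.pi * (1 + δ)) ^ p := by
    intro s hs hst
    have hσ : 0 < (1 + δ) * s := by positivity
    have hgi : Integrable fun y : EuclideanSpace ℝ (Fin d) =>
        gaussProfile d ((1 + δ) * s) (‖y - x‖ ^ 2) :=
      Integrable.of_integral_ne_zero (by rw [integral_gaussProfile hσ x]; exact one_ne_zero)
    have hbig := hgi.const_mul (N * (4 * Real.pi * (1 + δ)) ^ p)
    calc ∫ y in Metric.closedBall x ρ, ‖k s x y‖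
        ≤ ∫ y in Metric.closedBall x ρ, N * (4 * Real.pi * (1 + δ)) ^ p *
            gaussProfile d ((1 + δ) * s) (‖y - x‖ ^ 2) := by
          refine setIntegral_mono_on ((hucont s hs).norm.integrableOn_compact hK)
            hbig.integrableOn Metric.isClosed_closedBall.measurableSet fun y hy => ?_
          refine (hkb s hs hst y (hsubR hy)).trans (le_of_eq ?_)
          have e : (4 * Real.pi * (1 + δ)) ^ p * (4 * Real.pi * ((1 + δ) * s)) ^ (-p) =
              s ^ (-p) := by
            rw [show 4 * Real.pi * ((1 + δ) * s) = 4 * Real.pi * (1 + δ) * s by ring,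
              Real.mul_rpow (by positivity) hs.le, ← mul_assoc, ← Real.rpow_add (by positivity),
              add_neg_cancel, Real.rpow_zero, one_mul]
          rw [gaussProfile, ← hp, mul_assoc N, ← mul_assoc ((4 * Real.pi * (1 + δ)) ^ p), e,
            mul_assoc 4 (1 + δ) s]
      _ ≤ ∫ y, N * (4 * Real.pi * (1 + δ)) ^ p *
            gaussProfile d ((1 + δ) * s) (‖y - x‖ ^ 2) :=
          setIntegral_le_integral hbig (Eventually.of_forall fun y =>
            mul_nonneg (by positivity) (gaussProfile_pos hσ _).le)
      _ = _ := by rw [integral_const_mul, integral_gaussProfile hσ x, mul_one]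
  -- This integral is e^{-aH} applied to the test function `cutGauss η x t`, evaluated at `x`; hence
  -- the need for pointwise convergence.
  have hL : Tendsto (fun a => ∫ y, cutGauss η x t y • k a x y) (𝓝[>] 0)
      (𝓝 (((4 * Real.pi * t) ^ (-p) : ℝ) : ℂ)) := by
    have h1 := hk.tendsto_kernelAction hH hS (contDiff_cutGauss hη x t)
      (hasCompactSupport_cutGauss hρ h0 x t) ((tsupport_cutGauss_subset hρ h0 x t).trans hball) hx
    have e : cutGauss η x t x = (4 * Real.pi * t) ^ (-p) := by
      simp [cutGauss, gaussProfile, hη0, hp]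
    rwa [e] at h1
  set E := Real.exp (-(R ^ 2 / ((1 + δ') * t))) with hE
  have hE0 : 0 < E := Real.exp_pos _
  -- The last factor is (4πt)^{-p}; it cancels against the normalization (4πt)^p of the kernel on
  -- the diagonal.
  set B₀ := A * v * C * N * E * ((4 * Real.pi) ^ (-p) * t ^ (-p)) with hB
  have hB0 : 0 ≤ B₀ := by positivity
  have htp : 0 < t ^ p := by positivity
  have hcontQ : ContinuousOn (heatMajorant d R) (Icc 0 t) :=
    (continuousOn_heatMajorant d R).mono Icc_subset_Ici_self
  have hcontQ' : ContinuousOn (fun s => heatMajorant d R (t - s)) (Icc 0 t) :=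
    (continuousOn_heatMajorant d R).comp (by fun_prop) fun s hs => sub_nonneg.2 hs.2
  have hmain := hu.norm_sub_le hk.isOpen hρ hball hη h0 hη0 ht hM hL
    (β := fun s => B₀ * (heatMajorant d R s + heatMajorant d R (t - s)))
    (continuousOn_const.mul (hcontQ.add hcontQ'))
    (fun s hs => mul_nonneg hB0 (add_nonneg (heatMajorant_nonneg d R hs.1)
      (heatMajorant_nonneg d R (sub_nonneg.2 hs.2)))) ?_
  · have hcalc : ∫ s in (0 : ℝ)..t, B₀ * (heatMajorant d R s + heatMajorant d R (t - s)) ≤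
        B₀ * (4 * (1 + Real.posLog (Real.sqrt t / R)) ^ kappa d) := by
      rw [intervalIntegral.integral_const_mul, intervalIntegral.integral_add
        (hcontQ.intervalIntegrable_of_Icc ht.le) (hcontQ'.intervalIntegrable_of_Icc ht.le),
        intervalIntegral.integral_comp_sub_left (fun s => heatMajorant d R s) t, sub_self, sub_zero]
      have := integral_heatMajorant_le d hR ht
      gcongr
      linarith
    have hπt : 0 < (4 * Real.pi * t) ^ p := by positivity
    have hmul : (((4 * Real.pi * t) ^ p : ℝ) : ℂ) * k t x x - 1 =
        (((4 * Real.pi * t) ^ p : ℝ) : ℂ) * (k t x x - (((4 * Real.pi * t) ^ (-p) : ℝ) : ℂ)) := by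
      rw [mul_sub, ← Complex.ofReal_mul, ← Real.rpow_add (by positivity), add_neg_cancel,
        Real.rpow_zero, Complex.ofReal_one]
    rw [hmul, norm_mul, Complex.norm_real, Real.norm_of_nonneg hπt.le]
    have hlog : 0 ≤ 1 + Real.posLog (Real.sqrt t / R) := by
      have := Real.posLog_nonneg (x := Real.sqrt t / R)
      linarith
    have hcancel : (4 * Real.pi * t) ^ p * ((4 * Real.pi) ^ (-p) * t ^ (-p)) = 1 := by
      rw [← Real.mul_rpow (by positivity) ht.le, ← Real.rpow_add (by positivity), add_neg_cancel,
        Real.rpow_zero]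
    calc (4 * Real.pi * t) ^ p * ‖k t x x - (((4 * Real.pi * t) ^ (-p) : ℝ) : ℂ)‖
        ≤ (4 * Real.pi * t) ^ p *
          (B₀ * (4 * (1 + Real.posLog (Real.sqrt t / R)) ^ kappa d)) := by
          gcongr
          exact hmain.trans hcalc
      _ = ((4 * Real.pi * t) ^ p * ((4 * Real.pi) ^ (-p) * t ^ (-p))) *
          (4 * (A * v * C) * (1 + Real.posLog (Real.sqrt t / R)) ^ kappa d * E * N) := by
          rw [hB]; ring
      _ ≤ 4 * (A * (v + 1) * C) * (1 + Real.posLog (Real.sqrt t / R)) ^ kappa d * E * N := by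
          rw [hcancel, one_mul]
          gcongr
          linarith
  · intro s hs
    have hσ : 0 < t - s := sub_pos.2 hs.2
    have hpoint : ∀ y ∈ Metric.closedBall x ρ, ‖cutGaussCommutator η x (t - s) y • k s x y‖ ≤
        A * ((4 + 2 * d) / R ^ 2 + 2 / (t - s)) *
          ((4 * Real.pi * (t - s)) ^ (-p) * Real.exp (-(α * R ^ 2 / (4 * (t - s))))) *
          (N * (s ^ (-p) * Real.exp (-(α * R ^ 2 / (4 * (1 + δ) * s))))) := by
      intro y hy
      have hs0 : 0 < s := hs.1
      obtain ⟨hne, hle⟩ := abs_cutGaussCommutator_le hsm hβ2.le hz hA hbd hR x hσ y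
      by_cases hc : cutGaussCommutator η x (t - s) y = 0
      · rw [hc, zero_smul, norm_zero]
        positivity
      · have hr := hne hc
        rw [norm_smul, Real.norm_eq_abs]
        refine mul_le_mul hle ((hkb s hs.1 hs.2.le y (hsubR hy)).trans ?_) (norm_nonneg _)
          (by positivity)
        gcongr
    rw [← setIntegral_eq_integral_of_forall_compl_eq_zero (s := Metric.closedBall x ρ) fun y hy => by
      rw [cutGaussCommutator_eq_zero hρ h0 x _ hy, zero_smul]]
    refine (norm_setIntegral_le_of_norm_le_const hK.measure_lt_top hpoint).trans ?_
    -- The volume of the ball supplies the factor R^d in `exists_duhamel_integrand_bound`.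
    have hvol : volume.real (Metric.closedBall x ρ) ≤ (R ^ 2) ^ p * v := by
      rw [Measure.addHaar_real_closedBall _ _ hρ.le, finrank_euclideanSpace_fin]
      have e : (R ^ 2) ^ p = R ^ d := by
        rw [← Real.rpow_natCast R 2, ← Real.rpow_mul hR.le, ← Real.rpow_natCast R d, hp]
        congr 1
        push_cast
        ring
      rw [e]
      gcongr
    have hs0 : 0 < s := hs.1
    have hI := hint R s (t - s) t hR hs.1 hσ (by ring)
    rw [← hE] at hI
    have hcancel : t ^ (-p) * t ^ p = 1 := by
      rw [← Real.rpow_add ht, neg_add_cancel, Real.rpow_zero]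
    calc A * ((4 + 2 * d) / R ^ 2 + 2 / (t - s)) *
          ((4 * Real.pi * (t - s)) ^ (-p) * Real.exp (-(α * R ^ 2 / (4 * (t - s))))) *
          (N * (s ^ (-p) * Real.exp (-(α * R ^ 2 / (4 * (1 + δ) * s))))) *
          volume.real (Metric.closedBall x ρ)
        ≤ A * ((4 + 2 * d) / R ^ 2 + 2 / (t - s)) *
          ((4 * Real.pi * (t - s)) ^ (-p) * Real.exp (-(α * R ^ 2 / (4 * (t - s))))) *
          (N * (s ^ (-p) * Real.exp (-(α * R ^ 2 / (4 * (1 + δ) * s))))) *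
          ((R ^ 2) ^ p * v) := by gcongr
      _ = A * v * N * (4 * Real.pi) ^ (-p) * (t ^ (-p) * t ^ p) *
          ((R ^ 2) ^ p * (((4 + 2 * d) / R ^ 2 + 2 / (t - s)) *
          ((t - s) ^ (-p) * Real.exp (-(α * R ^ 2 / (4 * (t - s))))) *
          (s ^ (-p) * Real.exp (-(α * R ^ 2 / (4 * (1 + δ) * s)))))) := by
          rw [Real.mul_rpow (by positivity) hσ.le, hcancel]
          ring
      _ = A * v * N * ((4 * Real.pi) ^ (-p) * t ^ (-p)) *
          ((R ^ 2) ^ p * t ^ p * (((4 + 2 * d) / R ^ 2 + 2 / (t - s)) *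
          ((t - s) ^ (-p) * Real.exp (-(α * R ^ 2 / (4 * (t - s))))) *
          (s ^ (-p) * Real.exp (-(α * R ^ 2 / (4 * (1 + δ) * s)))))) := by ring
      _ ≤ A * v * N * ((4 * Real.pi) ^ (-p) * t ^ (-p)) *
          (C * E * (heatMajorant d R s + heatMajorant d R (t - s))) := by gcongr
      _ = B₀ * (heatMajorant d R s + heatMajorant d R (t - s)) := by rw [hB]; ring

/-- A finite Gaussian norm bounds a continuous kernel pointwise. -/
theorem norm_le_of_gNorm_ne_top {Ω : Set (EuclideanSpace ℝ (Fin d))} (hΩ : IsOpen Ω) {δ : ℝ}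
    {x : EuclideanSpace ℝ (Fin d)} {P : Set (ℝ × EuclideanSpace ℝ (Fin d))}
    {k : ℝ → EuclideanSpace ℝ (Fin d) → EuclideanSpace ℝ (Fin d) → ℂ}
    (hfin : gNorm Ω δ x P k ≠ ⊤) {s : ℝ} (hs : 0 < s) {y : EuclideanSpace ℝ (Fin d)} (hy : y ∈ Ω)
    (hP : (s, y) ∈ P) (hk : ContinuousOn (k s x) Ω) :
    ‖k s x y‖ ≤ (gNorm Ω δ x P k).toReal * (s ^ (-((d : ℝ) / 2)) *
      Real.exp (-(‖y - x‖ ^ 2 / (4 * (1 + δ) * s)))) := by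
  have hle : limsup (fun y' => ENNReal.ofReal (‖k s x y'‖ * s ^ ((d : ℝ) / 2) *
      Real.exp (‖x - y‖ ^ 2 / (4 * (1 + δ) * s)))) (𝓝[Ω] y) ≤ gNorm Ω δ x P k :=
    le_iSup₂_of_le (s, y) ⟨hP, hs, subset_closure hy⟩ le_rfl
  have hne : (𝓝[Ω] y).NeBot := by
    rw [hΩ.nhdsWithin_eq hy]; infer_instance
  have hlim : Tendsto (fun y' => ENNReal.ofReal (‖k s x y'‖ * s ^ ((d : ℝ) / 2) *
      Real.exp (‖x - y‖ ^ 2 / (4 * (1 + δ) * s)))) (𝓝[Ω] y)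
      (𝓝 (ENNReal.ofReal (‖k s x y‖ * s ^ ((d : ℝ) / 2) *
        Real.exp (‖x - y‖ ^ 2 / (4 * (1 + δ) * s))))) :=
    ENNReal.tendsto_ofReal ((((hk y hy).norm).mul_const _).mul_const _)
  rw [hlim.limsup_eq, ENNReal.ofReal_le_iff_le_toReal hfin] at hle
  have hsp : 0 < s ^ ((d : ℝ) / 2) := by positivity
  rw [norm_sub_rev x y] at hle
  rw [Real.rpow_neg hs.le, Real.exp_neg, ← mul_inv, ← div_eq_mul_inv, le_div_iff₀ (by positivity),
    ← mul_assoc]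
  exact hle

end MainEstimate

theorem proposition4p1 (d : ℕ) (hd : 2 ≤ d) (δ δ' : ℝ) (hδ : 0 < δ) (hδ' : δ < δ') :
    ∃ C : ℝ, 0 < C ∧
      ∀ (Ω : Set (EuclideanSpace ℝ (Fin d))), IsOpen Ω →
      ∀ (H : L2 Ω →ₗ.[ℂ] L2 Ω), IsNonnegSelfAdjointExtension Ω H →
      ∀ (k : ℝ → EuclideanSpace ℝ (Fin d) → EuclideanSpace ℝ (Fin d) → ℂ), IsHeatKernel H k →
      ∀ x ∈ Ω, ∀ t : ℝ, 0 < t →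
      ∀ R : ℝ, 0 < R → ENNReal.ofReal R ≤ Metric.infEDist x Ωᶜ →
        ENNReal.ofReal
            ‖(((4 * Real.pi * t) ^ ((d : ℝ) / 2) : ℝ) : ℂ) * k t x x - 1‖ ≤
          ENNReal.ofReal (C * (1 + Real.posLog (Real.sqrt t / R)) ^ kappa d *
              Real.exp (-(R ^ 2 / ((1 + δ') * t)))) *
            gNorm Ω δ x (Ioc 0 t ×ˢ Metric.ball x R) k := by
  obtain ⟨C, hC, hmain⟩ := exists_onDiagonal_bound hd hδ hδ'
  refine ⟨C, hC, ?_⟩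
  rintro Ω hΩ H hH k ⟨hkc, S, hS, hkS⟩ x hx t ht R hR hRd
  have hlog : 0 ≤ Real.posLog (Real.sqrt t / R) := Real.posLog_nonneg
  have hfac : 0 < C * (1 + Real.posLog (Real.sqrt t / R)) ^ kappa d *
      Real.exp (-(R ^ 2 / ((1 + δ') * t))) := by positivity
  -- Since 0 * ⊤ = 0 in `ℝ≥0∞`, the infinite case needs the prefactor to be strictly positive.
  rcases eq_or_ne (gNorm Ω δ x (Ioc 0 t ×ˢ Metric.ball x R) k) ⊤ with htop | hfin
  · rw [htop, ENNReal.mul_top (ENNReal.ofReal_pos.2 hfac).ne']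
    exact le_top
  · have hball : Metric.ball x R ⊆ Ω := by
      intro y hy
      by_contra hyΩ
      have h1 : Metric.infEDist x Ωᶜ ≤ edist x y := Metric.infEDist_le_edist_of_mem hyΩ
      have h2 : edist x y < ENNReal.ofReal R := by
        rw [edist_dist, ENNReal.ofReal_lt_ofReal_iff hR, dist_comm]
        exact hy
      exact absurd (hRd.trans h1) (not_le.2 h2)
    have hk : RepresentsSemigroup S k := ⟨hΩ, hkc, hkS⟩
    have hb := hmain Ω H S k hk hH hS x t R _ ht hR hball
      (ENNReal.toReal_nonneg (a := gNorm Ω δ x (Ioc 0 t ×ˢ Metric.ball x R) k))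
      fun s hs hst y hy => norm_le_of_gNorm_ne_top hΩ hfin hs (hball hy) ⟨⟨hs, hst⟩, hy⟩
        (hkc.comp (f := fun y => (s, x, y)) (by fun_prop) fun y hy => ⟨hs, hx, hy⟩)
    calc _ ≤ ENNReal.ofReal (C * (1 + Real.posLog (Real.sqrt t / R)) ^ kappa d *
          Real.exp (-(R ^ 2 / ((1 + δ') * t))) *
          (gNorm Ω δ x (Ioc 0 t ×ˢ Metric.ball x R) k).toReal) := ENNReal.ofReal_le_ofReal hb
      _ = _ := by rw [ENNReal.ofReal_mul hfac.le, ENNReal.ofReal_toReal hfin]
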